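/- Let $N\ge 1$ and let $K:\mathbb R^N\to[0,+\infty)$ satisfy $K(x)=K(-x)$ and $\min(|x|,1)K(x)\in L^1(\mathbb R^N)$. For measurable $E\subseteq\mathbb R^N$ and a nonnegative (possibly infinite-valued) kernel $H$ put $\mathrm{Per}_H(E)=\int_E\int_{\mathbb R^N\setminus E}H(x-y)\,dy\,dx$, and for $u\in L^1_{loc}(\mathbb R^N)$ put $J_K(u)=\frac12\int_{\mathbb R^N}\int_{\mathbb R^N}|u(x)-u(y)|K(x-y)\,dx\,dy\in[0,+\infty]$. For $m\ge 0$ let $B_m$ be the ball of volume $m$ centered at $0$, let $K^\star(x)=\int_0^{\infty}\chi_{B_{|\{K>t\}|}}(x)\,dt$ be the symmetric decreasing rearrangement of $K$, and let $g(m)=\mathrm{Per}_{K^\star}(B_m)$. Assume that there are $\mu,r>0$ with $K(x)\ge\mu$ for all $x$ with $|x|<r$, and that there are $k\ge 1$ and $C>0$ such that $$g(m)\ge \frac{m^{1/k}}{C}\qquad\text{for all } m>0.$$ For measurable $u$ let $m(u)=\inf\{s\in\mathbb R : |\{x: u(x)>s\}|<\infty\}\in[-\infty,+\infty]$. Then for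 every $u\in L^1_{loc}(\mathbb R^N)$ with $J_K(u)<\infty$ the number $m(u)$ is finite and $$\|u-m(u)\|_{L^k(\mathbb R^N)}\le C\,J_K(u),$$ with the same constant $C$. Moreover, $m(u)=0$ for every $u\in L^1(\mathbb R^N)$. -/

import Mathlib

open MeasureTheory
open scoped ENNReal NNReal

namespace NonlocalPerimeter

noncomputable section

/-- An admissible interaction kernel `K : ℝᴺ → [0, +∞)`: even, and with
`min (|x|, 1) K(x)` integrable. -/
structure IsKernel {N : ℕ} (K : EuclideanSpace ℝ (Fin N) → ℝ≥0) : Prop where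
  symm : ∀ x, K x = K (-x)
  integrable : Integrable (fun x => min ‖x‖ 1 * (K x : ℝ)) volume

/-- The `K`-perimeter `∫_E ∫_{ℝᴺ ∖ E} K(x - y)`, with values in `[0, +∞]`. -/
def per {N : ℕ} (K : EuclideanSpace ℝ (Fin N) → ℝ≥0∞)
    (E : Set (EuclideanSpace ℝ (Fin N))) : ℝ≥0∞ :=
  ∫⁻ x in E, ∫⁻ y in Eᶜ, K (x - y)

/-- The functional `J_K(u) = (1/2) ∫∫ |u(x) - u(y)| K(x - y) dx dy`, with values in `[0, +∞]`. -/
def energy {N : ℕ} (K : EuclideanSpace ℝ (Fin N) → ℝ≥0)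
    (u : EuclideanSpace ℝ (Fin N) → ℝ) : ℝ≥0∞ :=
  2⁻¹ * ∫⁻ x, ∫⁻ y, ‖u x - u y‖ₑ * (K (x - y) : ℝ≥0∞)

/-- The ball `B_m` of volume `m` centered at the origin, that is, of radius `(m / ω_N)^(1/N)`
where `ω_N` is the volume of the unit ball (`B_∞` is the whole space). -/
def ballOfVolume (N : ℕ) (m : ℝ≥0∞) : Set (EuclideanSpace ℝ (Fin N)) :=
  Metric.eball 0
    ((m / volume (Metric.ball (0 : EuclideanSpace ℝ (Fin N)) 1)) ^ ((1 : ℝ) / (N : ℝ)))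

/-- The symmetric decreasing rearrangement `h⋆(x) = ∫₀^∞ χ_{{h > t}⋆}(x) dt`, where `E⋆` is the
centered ball with the volume of `E`. It may take the value `+∞` (at the origin). -/
def rearrangement {N : ℕ} (h : EuclideanSpace ℝ (Fin N) → ℝ≥0) :
    EuclideanSpace ℝ (Fin N) → ℝ≥0∞ :=
  fun x => ∫⁻ t in Set.Ioi (0 : ℝ),
    (ballOfVolume N (volume {y | t < (h y : ℝ)})).indicator (fun _ => (1 : ℝ≥0∞)) x

/-- The isoperimetric profile `g(m) = Per_{K⋆}(B_m)`, for `0 ≤ m < ∞`. -/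
def profile {N : ℕ} (K : EuclideanSpace ℝ (Fin N) → ℝ≥0) (m : ℝ≥0) : ℝ≥0∞ :=
  per (rearrangement K) (ballOfVolume N m)

/-- `m(u) = inf {s ∈ ℝ : |{u > s}| < ∞}`, an infimum in the extended reals. -/
def levelInf {N : ℕ} (u : EuclideanSpace ℝ (Fin N) → ℝ) : EReal :=
  sInf ((fun s : ℝ => (s : EReal)) '' {s : ℝ | volume {x | s < u x} < ⊤})

end

end NonlocalPerimeter

/-!
The proof reduces the inequality for functions to an isoperimetric inequality for sets, which in
turn rests on Riesz's rearrangement inequality.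

*Rearrangement.* On the line, Riesz's inequality for three sets `E`, `F`, `A` follows from the
bound `∫∫ 1_E(x) 1_F(y) 1_A(x - y) ≤ t |A| + (|E| - t) (|F| - t)` (`interaction_real_le_of_lt`),
which comes from cutting off the initial parts of measure `t` of `E` and `F`; centered intervals
attain equality for `t = (|E| + |F| - |A|) / 2` (`mul_le_interaction_centered`). Slicing shows
that Steiner symmetrization in any direction does not decrease the interaction. Symmetrizing a set
`E` in direction `v` also increases its overlap with the ball `B` of the same volume by at least
the measure of the part of `E \ B` that the translation by `v` carries into `B \ E`. Averaging
over `v` produces a direction with a gain comparable to `|E \ B| ^ 2`, so that an infimum argument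
brings `E` and `A` simultaneously as close to balls as desired (`exists_near_balls`), with no
compactness needed.

*Isoperimetry.* Decomposing the kernel into its superlevel sets turns Riesz's inequality into
`profile K |E| ≤ per K E` for sets of finite volume (`profile_le_per`). A set of infinite volume
with infinite complement has infinite perimeter (`per_eq_top`): on a grid finer than the radius on
which the kernel is bounded below, finite perimeter leaves only finitely many pairs of
neighbouring cubes whose majorities differ. In dimension at least two this forces the majority set
of cubes to be finite or cofinite. On the line the set could also be close to a half line, but
then the kernel has a finite first moment at infinity, all intervals have bounded perimeter, and
this contradicts the power lower bound of the profile. Hence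
`min |E| |Eᶜ| ^ (1 / k) ≤ C * per K E` for every measurable `E` (`min_volume_rpow_le`).

*Functions.* By the coarea formula (`energy_eq_lintegral_per`), the energy of `u` bounds the
integral over `t` of `min |{u > t}| |{u ≤ t}| ^ (1 / k)`. If `|{u > t}|` were finite for all `t`,
or infinite for all `t`, the integrand would stay bounded below on a half line; hence the level
`a = levelInf u` is finite. Then `|u - a|` is the integral of the characteristic functions of
`{u > t}` for `t > a` and of `{u ≤ t}` for `t < a`, and Minkowski's integral inequality
(`lintegral_rpow_lintegral_le`) concludes.
-/

namespace NonlocalPerimeter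

/-! ### The three-set interaction functional -/

/-- The set of pairs `(x, y) ∈ E × F` whose difference lies in `A`. -/
def pairs {G : Type*} [Sub G] (E F A : Set G) : Set (G × G) :=
  {p | p.1 ∈ E ∧ p.2 ∈ F ∧ p.1 - p.2 ∈ A}

/-- The functional `∫∫ 1_E(x) 1_F(y) 1_A(x - y) dx dy` of the Riesz rearrangement inequality. -/
noncomputable def interaction {G : Type*} [MeasureSpace G] [Sub G] (E F A : Set G) : ℝ≥0∞ :=
  volume (pairs E F A)

section Pairs

variable {G : Type*} [MeasurableSpace G] [AddGroup G] [MeasurableSub₂ G]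

theorem measurableSet_pairs {E F A : Set G} (hE : MeasurableSet E) (hF : MeasurableSet F)
    (hA : MeasurableSet A) : MeasurableSet (pairs E F A) :=
  (measurable_fst hE).inter ((measurable_snd hF).inter
    ((measurable_fst.sub measurable_snd) hA))

end Pairs

theorem pairs_mono {G : Type*} [Sub G] {E E' F F' A A' : Set G} (hE : E ⊆ E') (hF : F ⊆ F')
    (hA : A ⊆ A') : pairs E F A ⊆ pairs E' F' A' :=
  fun _ hp => ⟨hE hp.1, hF hp.2.1, hA hp.2.2⟩

theorem interaction_mono {G : Type*} [MeasureSpace G] [Sub G] {E E' F F' A A' : Set G}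
    (hE : E ⊆ E') (hF : F ⊆ F') (hA : A ⊆ A') : interaction E F A ≤ interaction E' F' A' :=
  measure_mono (pairs_mono hE hF hA)

theorem interaction_le_mul {G : Type*} [MeasureSpace G] [Sub G] [SFinite (volume : Measure G)]
    (E F A : Set G) : interaction E F A ≤ volume E * volume F := by
  rw [← Measure.prod_prod]
  exact measure_mono fun p hp => ⟨hp.1, hp.2.1⟩

section Group

variable {G : Type*} [MeasureSpace G] [AddCommGroup G] [MeasurableAdd₂ G] [MeasurableNeg G]
  [SFinite (volume : Measure G)] [(volume : Measure G).IsAddRightInvariant]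

theorem interaction_le_mul_left [(volume : Measure G).IsNegInvariant]
    {E F A : Set G} (hE : MeasurableSet E) (hA : MeasurableSet A) :
    interaction E F A ≤ volume E * volume A := by
  have hψ := measurePreserving_prod_sub (volume : Measure G) (volume : Measure G)
  have : pairs E F A ⊆ (fun z : G × G => (z.1, z.2 - z.1)) ⁻¹' (E ×ˢ (-A)) := by
    intro p hp
    exact ⟨hp.1, by simpa using hp.2.2⟩
  calc interaction E F A ≤ _ := measure_mono this
    _ = volume E * volume (-A) := by
      rw [show (volume : Measure (G × G)) = (volume : Measure G).prod volume from rfl,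
        hψ.measure_preimage (hE.prod hA.neg).nullMeasurableSet, Measure.prod_prod]
    _ = _ := by rw [Measure.measure_neg]

theorem interaction_le_mul_right {E F A : Set G} (hF : MeasurableSet F) (hA : MeasurableSet A) :
    interaction E F A ≤ volume A * volume F := by
  have hψ := measurePreserving_sub_prod (volume : Measure G) (volume : Measure G)
  have : pairs E F A ⊆ (fun z : G × G => (z.1 - z.2, z.2)) ⁻¹' (A ×ˢ F) :=
    fun p hp => ⟨hp.2.2, hp.2.1⟩
  calc interaction E F A ≤ _ := measure_mono this
    _ = volume A * volume F := by
      rw [show (volume : Measure (G × G)) = (volume : Measure G).prod volume from rfl,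
        hψ.measure_preimage (hA.prod hF).nullMeasurableSet, Measure.prod_prod]

end Group

/-! ### Riesz's inequality on the line -/

theorem exists_measure_inter_Iic_eq {E : Set ℝ} (hE : MeasurableSet E) (hfin : volume E ≠ ⊤)
    {t : ℝ} (ht0 : 0 < t) (ht : t < volume.real E) :
    ∃ x, volume (E ∩ Set.Iic x) = ENNReal.ofReal t := by
  have hfin' : ∀ s : Set ℝ, volume (E ∩ s) ≠ ⊤ := fun s =>
    ne_top_of_le_ne_top hfin (measure_mono Set.inter_subset_left)
  have hle : ∀ x y : ℝ, volume.real (E ∩ Set.Iic x) ≤ volume.real (E ∩ Set.Iic y) + dist x y := by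
    intro x y
    have h1 : E ∩ Set.Iic x ⊆ (E ∩ Set.Iic y) ∪ Set.Ioc y x := by
      intro s hs
      by_cases h : s ≤ y
      · exact Or.inl ⟨hs.1, h⟩
      · exact Or.inr ⟨not_le.1 h, hs.2⟩
    calc volume.real (E ∩ Set.Iic x) ≤ volume.real ((E ∩ Set.Iic y) ∪ Set.Ioc y x) :=
          measureReal_mono h1 (measure_union_ne_top (hfin' _) (by simp))
      _ ≤ volume.real (E ∩ Set.Iic y) + volume.real (Set.Ioc y x) := measureReal_union_le _ _
      _ ≤ _ := by
        gcongr
        rw [Real.volume_real_Ioc, Real.dist_eq]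
        exact max_le (le_abs_self _) (abs_nonneg _)
  have hcont : Continuous fun x => volume.real (E ∩ Set.Iic x) :=
    (LipschitzWith.of_le_add hle).continuous
  have htop : ∃ x, t ≤ volume.real (E ∩ Set.Iic x) := by
    have h := tendsto_measure_Iic_atTop ((volume : Measure ℝ).restrict E)
    rw [Measure.restrict_apply_univ] at h
    obtain ⟨x, hx⟩ := (h.eventually (lt_mem_nhds
      (show ENNReal.ofReal t < volume E from
        (ENNReal.ofReal_lt_iff_lt_toReal ht0.le hfin).2 ht))).exists
    refine ⟨x, ?_⟩
    rw [Measure.restrict_apply measurableSet_Iic, Set.inter_comm] at hx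
    exact ((ENNReal.ofReal_lt_iff_lt_toReal ht0.le (hfin' _)).1 hx).le
  have hbot : ∃ x, volume.real (E ∩ Set.Iic x) ≤ t := by
    have h := tendsto_measure_Ici_atBot ((volume : Measure ℝ).restrict E)
    rw [Measure.restrict_apply_univ] at h
    obtain ⟨x, hx⟩ := (h.eventually (lt_mem_nhds
      (show ENNReal.ofReal (volume.real E - t) < volume E from
        (ENNReal.ofReal_lt_iff_lt_toReal (by linarith) hfin).2
          (by change _ < volume.real E; linarith)))).exists
    refine ⟨x, ?_⟩
    rw [Measure.restrict_apply measurableSet_Ici, Set.inter_comm] at hx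
    have hx' := (ENNReal.ofReal_lt_iff_lt_toReal (by linarith) (hfin' _)).1 hx
    have h2 : volume.real (E ∩ Set.Iic x) = volume.real (E ∩ Set.Iio x) := by
      refine measureReal_congr ?_
      exact (Filter.EventuallyEq.refl _ _).inter Iio_ae_eq_Iic.symm
    have h3 : volume.real (E ∩ Set.Ici x) + volume.real (E ∩ Set.Iio x) = volume.real E := by
      rw [← measureReal_union (Set.disjoint_left.2 ?_) (hE.inter measurableSet_Iio) (hfin' _)
        (hfin' _),
        ← Set.inter_union_distrib_left, Set.Ici_union_Iio, Set.inter_univ]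
      intro s hs hs'
      exact not_lt.2 (Set.mem_Ici.1 hs.2) (Set.mem_Iio.1 hs'.2)
    change _ < volume.real _ at hx'
    linarith
  obtain ⟨x₁, h₁⟩ := htop
  obtain ⟨x₂, h₂⟩ := hbot
  obtain ⟨x, hx⟩ := mem_range_of_exists_le_of_exists_ge hcont ⟨x₂, h₂⟩ ⟨x₁, h₁⟩
  exact ⟨x, by rw [← hx]; exact (ofReal_measureReal (hfin' _)).symm⟩

/-- Pollard-type estimate: the pairs are split according to whether one of the two points lies in
the initial part of measure `t` of its set. The fibres of the difference map over the pairs of the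
first kind have measure at most `t`; the other pairs form a product set. -/
theorem interaction_real_le_of_lt {E F A : Set ℝ} (hE : MeasurableSet E) (hF : MeasurableSet F)
    (hA : MeasurableSet A) (hEf : volume E ≠ ⊤) (hFf : volume F ≠ ⊤)
    {t : ℝ} (ht0 : 0 < t) (htE : t < volume.real E) (htF : t < volume.real F) :
    interaction E F A ≤ ENNReal.ofReal t * volume A +
      ENNReal.ofReal (volume.real E - t) * ENNReal.ofReal (volume.real F - t) := by
  obtain ⟨x₀, hx₀⟩ := exists_measure_inter_Iic_eq hE hEf ht0 htE
  obtain ⟨y₀, hy₀⟩ := exists_measure_inter_Iic_eq hF hFf ht0 htF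
  have tail : ∀ {D : Set ℝ} {x : ℝ}, volume D ≠ ⊤ → volume (D ∩ Set.Iic x) = ENNReal.ofReal t →
      volume (D \ Set.Iic x) = ENNReal.ofReal (volume.real D - t) := by
    intro D x hD h
    have := measure_sdiff_add_inter (μ := volume) D (measurableSet_Iic (a := x))
    rw [h] at this
    rw [ENNReal.ofReal_sub _ ht0.le, Measure.real, ENNReal.ofReal_toReal hD, ← this,
      ENNReal.add_sub_cancel_right ENNReal.ofReal_ne_top]
  set P₁ : Set (ℝ × ℝ) := pairs E F A ∩ {p | p.1 ≤ x₀ ∨ p.2 ≤ y₀} with hP₁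
  have hP₁m : MeasurableSet P₁ := (measurableSet_pairs hE hF hA).inter
    ((measurable_fst measurableSet_Iic).union (measurable_snd measurableSet_Iic))
  have hsub : pairs E F A ⊆ P₁ ∪ (E \ Set.Iic x₀) ×ˢ (F \ Set.Iic y₀) := by
    intro p hp
    by_cases h : p.1 ≤ x₀ ∨ p.2 ≤ y₀
    · exact Or.inl ⟨hp, h⟩
    · push Not at h
      exact Or.inr ⟨⟨hp.1, not_le.2 h.1⟩, ⟨hp.2.1, not_le.2 h.2⟩⟩
  have h1 : volume P₁ ≤ ENNReal.ofReal t * volume A := by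
    have hψ := measurePreserving_add_prod (volume : Measure ℝ) (volume : Measure ℝ)
    rw [show (volume : Measure (ℝ × ℝ)) = (volume : Measure ℝ).prod volume from rfl,
      ← hψ.measure_preimage hP₁m.nullMeasurableSet, Measure.prod_apply (hψ.measurable hP₁m)]
    calc _ ≤ ∫⁻ z, A.indicator (fun _ => ENNReal.ofReal t) z := by
          refine lintegral_mono fun z => ?_
          by_cases hz : z ∈ A
          · rw [Set.indicator_of_mem hz]
            rcases le_total y₀ (x₀ - z) with h | h
            · calc _ ≤ volume ((fun y => y + z) ⁻¹' (E ∩ Set.Iic x₀)) := by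
                    refine measure_mono ?_
                    rintro y ⟨⟨hy1, -, -⟩, hy⟩
                    simp only [Set.mem_preimage, Set.mem_inter_iff, Set.mem_Iic] at *
                    refine ⟨by rwa [add_comm], ?_⟩
                    rcases hy with hy | hy <;> simp only at hy <;> linarith
                _ = _ := by rw [measure_preimage_add_right, hx₀]
            · calc _ ≤ volume (F ∩ Set.Iic y₀) := by
                    refine measure_mono ?_
                    rintro y ⟨⟨-, hy1, -⟩, hy⟩
                    simp only [Set.mem_inter_iff, Set.mem_Iic] at *
                    refine ⟨hy1, ?_⟩
                    rcases hy with hy | hy <;> simp only at hy <;> linarith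
                _ = _ := hy₀
                _ ≤ _ := le_rfl
          · rw [Set.indicator_of_notMem hz]
            refine le_of_eq (measure_mono_null ?_ measure_empty)
            rintro y ⟨⟨-, -, hy⟩, -⟩
            exact hz (by simpa using hy)
      _ = _ := by rw [lintegral_indicator hA, setLIntegral_const]
  calc interaction E F A ≤ volume P₁ + volume ((E \ Set.Iic x₀) ×ˢ (F \ Set.Iic y₀)) :=
        (measure_mono hsub).trans (measure_union_le _ _)
    _ ≤ _ := by
      rw [show (volume : Measure (ℝ × ℝ)) = (volume : Measure ℝ).prod volume from rfl] at h1 ⊢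
      rw [Measure.prod_prod, tail hEf hx₀, tail hFf hy₀]
      gcongr

/-- The open interval of length `m` centered at the origin. -/
def centered (m : ℝ≥0∞) : Set ℝ := {s | ENNReal.ofReal (2 * |s|) < m}

theorem mem_centered_ofReal {a s : ℝ} : s ∈ centered (ENNReal.ofReal a) ↔ 2 * |s| < a := by
  exact ENNReal.ofReal_lt_ofReal_iff_of_nonneg (by positivity)

theorem centered_ofReal (a : ℝ) :
    centered (ENNReal.ofReal a) = Set.Ioo (-(a / 2)) (a / 2) := by
  ext s
  rw [mem_centered_ofReal, Set.mem_Ioo, ← abs_lt]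
  constructor <;> intro h <;> linarith

theorem volume_centered (m : ℝ≥0∞) : volume (centered m) = m := by
  induction m using ENNReal.recTopCoe with
  | top =>
    have : centered ⊤ = Set.univ := Set.eq_univ_of_forall fun s => ENNReal.ofReal_lt_top
    rw [this, Real.volume_univ]
  | coe m =>
    rw [← ENNReal.ofReal_coe_nnreal, centered_ofReal, Real.volume_Ioo]
    congr 1; ring

theorem centered_mono {m m' : ℝ≥0∞} (h : m ≤ m') : centered m ⊆ centered m' :=
  fun _ hs => lt_of_lt_of_le hs h

theorem volume_triangle (p q : ℝ) {t : ℝ} (ht : 0 ≤ t) :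
    volume {z : ℝ × ℝ | z.1 < p ∧ q < z.2 ∧ z.2 < z.1 - p + q + t} ≤
      ENNReal.ofReal (t ^ 2 / 2) := by
  have hsub : {z : ℝ × ℝ | z.1 < p ∧ q < z.2 ∧ z.2 < z.1 - p + q + t} ⊆
      regionBetween (fun _ => q) (fun x => x - p + q + t) (Set.Ioc (p - t) p) := by
    rintro ⟨x, y⟩ ⟨h1, h2, h3⟩
    simp only at h1 h2 h3
    exact ⟨⟨by linarith, h1.le⟩, h2, h3⟩
  refine (measure_mono hsub).trans ?_
  rw [show (volume : Measure (ℝ × ℝ)) = (volume : Measure ℝ).prod volume from rfl,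
    volume_regionBetween_eq_integral]
  · refine ENNReal.ofReal_le_ofReal (le_of_eq ?_)
    rw [← intervalIntegral.integral_of_le (by linarith)]
    simp only [Pi.sub_apply]
    have : ∀ x : ℝ, x - p + q + t - q = x - (p - t) := fun x => by ring
    simp only [this]
    rw [intervalIntegral.integral_sub (by simp) (by simp), integral_id,
      intervalIntegral.integral_const]
    simp only [smul_eq_mul]
    ring
  · exact (continuous_const.integrableOn_Ioc)
  · exact (Continuous.integrableOn_Ioc (by fun_prop))
  · exact measurableSet_Ioc
  · intro x hx
    simp only [Set.mem_Ioc] at hx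
    linarith [hx.1]

/-- The pairs of points of two centered intervals at distance at least `c / 2` fill two right
triangles with legs `t = (a + b - c) / 2`. -/
theorem mul_le_interaction_centered {a b c : ℝ} (hc : c ≤ a + b) :
    ENNReal.ofReal a * ENNReal.ofReal b ≤
      interaction (centered (ENNReal.ofReal a)) (centered (ENNReal.ofReal b))
        (centered (ENNReal.ofReal c)) + ENNReal.ofReal (((a + b - c) / 2) ^ 2) := by
  set t := (a + b - c) / 2 with ht
  have ht0 : 0 ≤ t := by rw [ht]; linarith
  set T : ℝ → ℝ → Set (ℝ × ℝ) := fun p q => {z | z.1 < p ∧ q < z.2 ∧ z.2 < z.1 - p + q + t} with hT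
  have hnull : volume {z : ℝ × ℝ | |z.1 - z.2| = c / 2} = 0 := by
    have hm : MeasurableSet {z : ℝ × ℝ | |z.1 - z.2| = c / 2} :=
      measurableSet_eq_fun (by fun_prop) measurable_const
    rw [show (volume : Measure (ℝ × ℝ)) = (volume : Measure ℝ).prod volume from rfl,
      Measure.measure_prod_null hm]
    refine Filter.Eventually.of_forall fun x => ?_
    refine measure_mono_null (t := {x - c / 2, x + c / 2}) ?_ (Set.Finite.measure_zero (by simp) _)
    intro y (hy : |x - y| = c / 2)
    rcases abs_cases (x - y) with h | h
    · left; linarith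
    · right; rw [Set.mem_singleton_iff]; linarith
  have hsub : centered (ENNReal.ofReal a) ×ˢ centered (ENNReal.ofReal b) ⊆
      pairs (centered (ENNReal.ofReal a)) (centered (ENNReal.ofReal b))
        (centered (ENNReal.ofReal c)) ∪ (T (a / 2) (-(b / 2)) ∪ Prod.swap ⁻¹' T (b / 2) (-(a / 2)) ∪
          {z : ℝ × ℝ | |z.1 - z.2| = c / 2}) := by
    rintro ⟨x, y⟩ ⟨hx, hy⟩
    have hx' := hx
    have hy' := hy
    rw [centered_ofReal, Set.mem_Ioo] at hx' hy'
    simp only at hx' hy'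
    by_cases h : x - y ∈ centered (ENNReal.ofReal c)
    · exact Or.inl ⟨hx, hy, h⟩
    · right
      rw [mem_centered_ofReal, not_lt] at h
      rcases eq_or_lt_of_le (show c / 2 ≤ |x - y| by linarith) with h' | h'
      · exact Or.inr h'.symm
      · left
        rcases lt_abs.1 h' with h' | h'
        · exact Or.inl ⟨hx'.2, hy'.1, by simp only [ht]; linarith⟩
        · exact Or.inr ⟨hy'.2, hx'.1, by simp only [Prod.swap, ht]; linarith⟩
  have hswap : volume (Prod.swap ⁻¹' T (b / 2) (-(a / 2))) = volume (T (b / 2) (-(a / 2))) := by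
    have := Measure.measurePreserving_swap (μ := (volume : Measure ℝ)) (ν := (volume : Measure ℝ))
    refine this.measure_preimage (MeasurableSet.nullMeasurableSet ?_)
    exact (measurableSet_lt measurable_fst measurable_const).inter
      ((measurableSet_lt measurable_const measurable_snd).inter
        (measurableSet_lt measurable_snd (by fun_prop)))
  calc ENNReal.ofReal a * ENNReal.ofReal b
      = volume (centered (ENNReal.ofReal a) ×ˢ centered (ENNReal.ofReal b)) := by
        rw [show (volume : Measure (ℝ × ℝ)) = (volume : Measure ℝ).prod volume from rfl,
          Measure.prod_prod, volume_centered, volume_centered]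
    _ ≤ interaction (centered (ENNReal.ofReal a)) (centered (ENNReal.ofReal b))
        (centered (ENNReal.ofReal c)) + (volume (T (a / 2) (-(b / 2))) +
          volume (Prod.swap ⁻¹' T (b / 2) (-(a / 2))) +
          volume {z : ℝ × ℝ | |z.1 - z.2| = c / 2}) :=
        (measure_mono hsub).trans <| (measure_union_le _ _).trans <| add_le_add le_rfl <|
          (measure_union_le _ _).trans <| add_le_add (measure_union_le _ _) le_rfl
    _ ≤ _ := by
      gcongr
      rw [hnull, add_zero, hswap]
      calc _ ≤ ENNReal.ofReal (t ^ 2 / 2) + ENNReal.ofReal (t ^ 2 / 2) :=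
            add_le_add (volume_triangle _ _ ht0) (volume_triangle _ _ ht0)
        _ = _ := by
          rw [← ENNReal.ofReal_add (by positivity) (by positivity)]
          congr 1; ring

/-- **Riesz's rearrangement inequality** for three sets of finite measure on the line. -/
theorem interaction_real_le {E F A : Set ℝ} (hE : MeasurableSet E) (hF : MeasurableSet F)
    (hA : MeasurableSet A) (hEf : volume E ≠ ⊤) (hFf : volume F ≠ ⊤) (hAf : volume A ≠ ⊤) :
    interaction E F A ≤
      interaction (centered (volume E)) (centered (volume F)) (centered (volume A)) := by
  have key : ∀ {x y z s : ℝ≥0∞}, s ≠ ⊤ → x ≤ y → y + s ≤ z + s → x ≤ z := fun hs h1 h2 =>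
    h1.trans ((ENNReal.add_le_add_iff_right hs).1 h2)
  obtain ⟨a, ha0, ha⟩ : ∃ a : ℝ, 0 ≤ a ∧ volume E = ENNReal.ofReal a :=
    ⟨volume.real E, by positivity, by rw [ofReal_measureReal hEf]⟩
  obtain ⟨b, hb0, hb⟩ : ∃ b : ℝ, 0 ≤ b ∧ volume F = ENNReal.ofReal b :=
    ⟨volume.real F, by positivity, by rw [ofReal_measureReal hFf]⟩
  obtain ⟨c, hc0, hc⟩ : ∃ c : ℝ, 0 ≤ c ∧ volume A = ENNReal.ofReal c :=
    ⟨volume.real A, by positivity, by rw [ofReal_measureReal hAf]⟩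
  rcases le_or_gt (a + b) c with h1 | h1
  · calc interaction E F A ≤ volume E * volume F := interaction_le_mul _ _ _
      _ ≤ interaction (centered (ENNReal.ofReal a)) (centered (ENNReal.ofReal b))
          (centered (ENNReal.ofReal (a + b))) := by
        have := mul_le_interaction_centered (a := a) (b := b) (c := a + b) le_rfl
        simpa [ha, hb] using this
      _ ≤ _ := by
        rw [ha, hb, hc]
        exact interaction_mono le_rfl le_rfl (centered_mono (ENNReal.ofReal_le_ofReal h1))
  rcases le_or_gt (a + c) b with h2 | h2
  · calc interaction E F A ≤ volume E * volume A := interaction_le_mul_left hE hA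
      _ ≤ interaction (centered (ENNReal.ofReal a)) (centered (ENNReal.ofReal (a + c)))
          (centered (ENNReal.ofReal c)) := by
        refine key (s := ENNReal.ofReal (a ^ 2)) ENNReal.ofReal_ne_top le_rfl ?_
        have := mul_le_interaction_centered (a := a) (b := a + c) (c := c) (by linarith)
        rw [show (a + (a + c) - c) / 2 = a by ring, ← ENNReal.ofReal_mul ha0,
          show a * (a + c) = a * c + a ^ 2 by ring,
          ENNReal.ofReal_add (by positivity) (by positivity), ENNReal.ofReal_mul ha0] at this
        rwa [ha, hc]
      _ ≤ _ := by
        rw [ha, hb, hc]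
        exact interaction_mono le_rfl (centered_mono (ENNReal.ofReal_le_ofReal h2)) le_rfl
  rcases le_or_gt (b + c) a with h3 | h3
  · calc interaction E F A ≤ volume A * volume F := interaction_le_mul_right hF hA
      _ ≤ interaction (centered (ENNReal.ofReal (b + c))) (centered (ENNReal.ofReal b))
          (centered (ENNReal.ofReal c)) := by
        refine key (s := ENNReal.ofReal (b ^ 2)) ENNReal.ofReal_ne_top le_rfl ?_
        have := mul_le_interaction_centered (a := b + c) (b := b) (c := c) (by linarith)
        rw [show (b + c + b - c) / 2 = b by ring, ← ENNReal.ofReal_mul (by linarith),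
          show (b + c) * b = c * b + b ^ 2 by ring,
          ENNReal.ofReal_add (by positivity) (by positivity), ENNReal.ofReal_mul hc0] at this
        rwa [hb, hc]
      _ ≤ _ := by
        rw [ha, hb, hc]
        exact interaction_mono (centered_mono (ENNReal.ofReal_le_ofReal h3)) le_rfl le_rfl
  -- In the remaining case both estimates are sharp for the same cut-off.
  have hEa : volume.real E = a := by rw [measureReal_def, ha, ENNReal.toReal_ofReal ha0]
  have hFb : volume.real F = b := by rw [measureReal_def, hb, ENNReal.toReal_ofReal hb0]
  have hup := interaction_real_le_of_lt hE hF hA hEf hFf (t := (a + b - c) / 2)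
    (by linarith) (by rw [hEa]; linarith) (by rw [hFb]; linarith)
  have hlow := mul_le_interaction_centered (a := a) (b := b) (c := c) (by linarith)
  rw [ha, hb, hc]
  rw [hEa, hFb, hc] at hup
  refine key (s := ENNReal.ofReal (((a + b - c) / 2) ^ 2)) ENNReal.ofReal_ne_top hup
    (le_trans (le_of_eq ?_) hlow)
  rw [← ENNReal.ofReal_mul (by linarith), ← ENNReal.ofReal_mul (by linarith),
    ← ENNReal.ofReal_mul ha0,
    ← ENNReal.ofReal_add (mul_nonneg (by linarith) hc0) (mul_nonneg (by linarith) (by linarith)),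
    ← ENNReal.ofReal_add (add_nonneg (mul_nonneg (by linarith) hc0)
      (mul_nonneg (by linarith) (by linarith))) (by positivity)]
  congr 1; ring

/-! ### Steiner symmetrization in a product -/

section Steiner

variable {W : Type*}

/-- The slice of `E ⊆ ℝ × W` over `w`. -/
def slice (E : Set (ℝ × W)) (w : W) : Set ℝ := (fun s => (s, w)) ⁻¹' E

/-- The Steiner symmetrization of `E ⊆ ℝ × W` in the direction of the first factor: each slice is
replaced by the centered open interval of the same length. -/
def steiner (E : Set (ℝ × W)) : Set (ℝ × W) := {p | p.1 ∈ centered (volume (slice E p.2))}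

theorem slice_steiner (E : Set (ℝ × W)) (w : W) :
    slice (steiner E) w = centered (volume (slice E w)) := rfl

theorem steiner_subset {E D : Set (ℝ × W)} {β : W → ℝ≥0∞} (hD : ∀ w, slice D w = centered (β w))
    (hED : E ⊆ D) : steiner E ⊆ D := by
  rintro ⟨s, w⟩ hs
  have h1 : s ∈ slice D w := by
    rw [hD]
    refine centered_mono ?_ hs
    rw [← volume_centered (β w), ← hD]
    exact measure_mono (Set.preimage_mono hED)
  exact h1

theorem measurableSet_slice [MeasurableSpace W] {E : Set (ℝ × W)} (hE : MeasurableSet E) (w : W) :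
    MeasurableSet (slice E w) :=
  measurable_prodMk_right hE

theorem measurableSet_steiner [MeasurableSpace W] {E : Set (ℝ × W)} (hE : MeasurableSet E) :
    MeasurableSet (steiner E) :=
  measurableSet_lt (by fun_prop) ((measurable_measure_prodMk_right hE).comp measurable_snd)

variable [MeasureSpace W] [SFinite (volume : Measure W)]

theorem volume_eq_lintegral_slice {E : Set (ℝ × W)} (hE : MeasurableSet E) :
    volume E = ∫⁻ w, volume (slice E w) :=
  Measure.prod_apply_symm hE

theorem volume_steiner {E : Set (ℝ × W)} (hE : MeasurableSet E) :
    volume (steiner E) = volume E := by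
  rw [volume_eq_lintegral_slice hE, volume_eq_lintegral_slice (measurableSet_steiner hE)]
  simp only [slice_steiner, volume_centered]

theorem interaction_prod [AddGroup W] [MeasurableSub₂ W] {E F A : Set (ℝ × W)}
    (hE : MeasurableSet E) (hF : MeasurableSet F) (hA : MeasurableSet A) :
    interaction E F A =
      ∫⁻ w, ∫⁻ w', interaction (slice E w) (slice F w') (slice A (w - w')) := by
  have : MeasurableSub₂ (ℝ × W) :=
    ⟨(measurable_fst.fst.sub measurable_snd.fst).prodMk (measurable_fst.snd.sub measurable_snd.snd)⟩
  have hP := measurableSet_pairs hE hF hA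
  have hmeas : Measurable fun z : (ℝ × W) × W =>
      volume {s' : ℝ | (z.1, (s', z.2)) ∈ pairs E F A} := by
    have : MeasurableSet {q : ((ℝ × W) × W) × ℝ | (q.1.1, (q.2, q.1.2)) ∈ pairs E F A} :=
      (show Measurable fun q : ((ℝ × W) × W) × ℝ => (q.1.1, (q.2, q.1.2)) by fun_prop) hP
    exact measurable_measure_prodMk_left this
  calc interaction E F A = ∫⁻ x : ℝ × W, volume {y | (x, y) ∈ pairs E F A} :=
        Measure.prod_apply hP
    _ = ∫⁻ x : ℝ × W, ∫⁻ w', volume {s' : ℝ | (x, (s', w')) ∈ pairs E F A} := by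
        refine lintegral_congr fun x => ?_
        exact Measure.prod_apply_symm (measurable_prodMk_left hP)
    _ = ∫⁻ w, ∫⁻ s : ℝ, ∫⁻ w', volume {s' : ℝ | ((s, w), (s', w')) ∈ pairs E F A} :=
        lintegral_prod_symm' _ hmeas.lintegral_prod_right'
    _ = ∫⁻ w, ∫⁻ w', ∫⁻ s : ℝ, volume {s' : ℝ | ((s, w), (s', w')) ∈ pairs E F A} := by
        refine lintegral_congr fun w => lintegral_lintegral_swap ?_
        exact (hmeas.comp
          (show Measurable fun q : ℝ × W => ((q.1, w), q.2) by fun_prop)).aemeasurable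
    _ = _ := by
        refine lintegral_congr fun w => lintegral_congr fun w' => ?_
        exact (Measure.prod_apply (measurableSet_pairs (measurableSet_slice hE w)
          (measurableSet_slice hF w') (measurableSet_slice hA (w - w')))).symm

theorem interaction_le_steiner [AddGroup W] [MeasurableSub₂ W] {E F A : Set (ℝ × W)}
    (hE : MeasurableSet E) (hF : MeasurableSet F) (hA : MeasurableSet A)
    (hEf : ∀ w, volume (slice E w) ≠ ⊤) (hFf : ∀ w, volume (slice F w) ≠ ⊤)
    (hAf : ∀ w, volume (slice A w) ≠ ⊤) :
    interaction E F A ≤ interaction (steiner E) (steiner F) (steiner A) := by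
  rw [interaction_prod hE hF hA, interaction_prod (measurableSet_steiner hE)
    (measurableSet_steiner hF) (measurableSet_steiner hA)]
  exact lintegral_mono fun w => lintegral_mono fun w' =>
    interaction_real_le (measurableSet_slice hE w) (measurableSet_slice hF w')
      (measurableSet_slice hA _) (hEf _) (hFf _) (hAf _)

/-- Symmetrization gains overlap with a set `B` that is already symmetrized: on each line, the part
of `E \ B` that a translation moves into `B \ E` is added to the overlap. -/
theorem volume_inter_add_le_volume_steiner_inter [AddGroup W] {E B : Set (ℝ × W)}
    (hE : MeasurableSet E) (hB : MeasurableSet B) {β : W → ℝ≥0∞}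
    (hBβ : ∀ w, slice B w = centered (β w)) (l : ℝ) :
    volume (E ∩ B) + volume ((E \ B) ∩ {p | (p.1 + l, p.2) ∈ B \ E}) ≤
      volume (steiner E ∩ B) := by
  have hM : MeasurableSet ((E \ B) ∩ {p | (p.1 + l, p.2) ∈ B \ E}) :=
    (hE.diff hB).inter ((show Measurable fun p : ℝ × W => (p.1 + l, p.2) by fun_prop) (hB.diff hE))
  rw [volume_eq_lintegral_slice (hE.inter hB), volume_eq_lintegral_slice hM,
    volume_eq_lintegral_slice ((measurableSet_steiner hE).inter hB),
    ← lintegral_add_left (show Measurable fun w => volume (slice (E ∩ B) w) from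
      measurable_measure_prodMk_right (hE.inter hB))]
  refine lintegral_mono fun w => ?_
  set e := slice E w with he
  set b := slice B w with hb
  have hem : MeasurableSet e := measurableSet_slice hE w
  have hbm : MeasurableSet b := measurableSet_slice hB w
  have h1 : volume (e ∩ b) + volume ((e \ b) ∩ {s | s + l ∈ b \ e}) ≤ volume e := by
    rw [← measure_inter_add_sdiff e hbm]
    gcongr
    exact Set.inter_subset_left
  have h2 : volume (e ∩ b) + volume ((e \ b) ∩ {s | s + l ∈ b \ e}) ≤ volume b := by
    rw [← measure_inter_add_sdiff b hem, Set.inter_comm]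
    refine add_le_add le_rfl ?_
    calc _ ≤ volume ((fun s => s + l) ⁻¹' (b \ e)) := measure_mono Set.inter_subset_right
      _ = _ := measure_preimage_add_right _ _ _
  have h3 : slice (steiner E ∩ B) w = centered (volume e) ∩ centered (volume b) := by
    rw [hb, hBβ w, volume_centered, ← hBβ w]; rfl
  rw [h3]
  change volume (e ∩ b) + volume ((e \ b) ∩ {s | s + l ∈ b \ e}) ≤ _
  rcases le_total (volume e) (volume b) with h | h
  · rwa [Set.inter_eq_left.2 (centered_mono h), volume_centered]
  · rwa [Set.inter_eq_right.2 (centered_mono h), volume_centered]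

end Steiner

/-! ### Steiner symmetrization in a direction of Euclidean space -/

theorem exists_coordinates {n : ℕ} {v : EuclideanSpace ℝ (Fin (n + 1))} (hv : v ≠ 0) :
    ∃ Φ : EuclideanSpace ℝ (Fin (n + 1)) ≃ᵐ ℝ × (Fin n → ℝ),
      MeasurePreserving Φ volume volume ∧ (∀ x y, Φ (x - y) = Φ x - Φ y) ∧
      (∀ x, Φ (x + v) = ((Φ x).1 + ‖v‖, (Φ x).2)) ∧
      ∀ x, ‖x‖ ^ 2 = (Φ x).1 ^ 2 + ∑ i, (Φ x).2 i ^ 2 := by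
  have hv' : ‖v‖ ≠ 0 := norm_ne_zero_iff.2 hv
  obtain ⟨b, hb⟩ := Orthonormal.exists_orthonormalBasis_extension_of_card_eq (𝕜 := ℝ)
    (E := EuclideanSpace ℝ (Fin (n + 1))) (ι := Fin (n + 1)) (by simp)
    (v := fun _ => ‖v‖⁻¹ • v) (s := {0}) (by
      constructor
      · rintro ⟨i, hi⟩
        simp [norm_smul, hv']
      · rintro ⟨i, hi⟩ ⟨j, hj⟩ hij
        simp only [Set.mem_singleton_iff] at hi hj
        exact absurd (Subtype.ext (hi.trans hj.symm)) hij)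
  have hb0 : b 0 = ‖v‖⁻¹ • v := hb 0 rfl
  have hrepr : b.repr v = EuclideanSpace.single 0 ‖v‖ := by
    have : v = ‖v‖ • b 0 := by rw [hb0, smul_smul, mul_inv_cancel₀ hv', one_smul]
    conv_lhs => rw [this]
    rw [map_smul, b.repr_self]
    ext i
    simp
  refine ⟨(b.repr.toHomeomorph.toMeasurableEquiv.trans
    (MeasurableEquiv.toLp 2 (Fin (n + 1) → ℝ)).symm).trans
      (MeasurableEquiv.piFinSuccAbove (fun _ => ℝ) 0), ?_, ?_, ?_, ?_⟩
  · exact (volume_preserving_piFinSuccAbove (fun _ : Fin (n + 1) => ℝ) 0).comp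
      ((PiLp.volume_preserving_ofLp _).comp b.measurePreserving_repr)
  · intro x y
    ext i <;> simp [MeasurableEquiv.piFinSuccAbove, Fin.tail]
  · intro x
    ext i <;> simp [MeasurableEquiv.piFinSuccAbove, Fin.tail, hrepr]
  · intro x
    rw [← b.repr.norm_map x, EuclideanSpace.norm_sq_eq, Fin.sum_univ_succ]
    simp [MeasurableEquiv.piFinSuccAbove, Fin.tail]

/-- Steiner symmetrization `S` in the direction `v`: it preserves volume and containment in centered
balls, gains overlap with every centered ball, and does not decrease the interaction. -/
theorem exists_symmetrization {N : ℕ} {v : EuclideanSpace ℝ (Fin N)} (hv : v ≠ 0) :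
    ∃ S : Set (EuclideanSpace ℝ (Fin N)) → Set (EuclideanSpace ℝ (Fin N)),
      (∀ E, MeasurableSet E → MeasurableSet (S E) ∧ volume (S E) = volume E) ∧
      (∀ E R, 0 ≤ R → E ⊆ Metric.ball 0 R → S E ⊆ Metric.ball 0 R) ∧
      (∀ E ρ, MeasurableSet E → 0 ≤ ρ →
        volume (E ∩ Metric.ball 0 ρ) + volume ((E \ Metric.ball 0 ρ) ∩
          {x | x + v ∈ Metric.ball 0 ρ \ E}) ≤ volume (S E ∩ Metric.ball 0 ρ)) ∧
      (∀ E A R, MeasurableSet E → MeasurableSet A → 0 ≤ R → E ⊆ Metric.ball 0 R →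
        A ⊆ Metric.ball 0 R → interaction E E A ≤ interaction (S E) (S E) (S A)) := by
  obtain ⟨n, rfl⟩ : ∃ n, N = n + 1 := by
    refine ⟨N - 1, (Nat.succ_pred_eq_of_ne_zero ?_).symm⟩
    rintro rfl
    exact hv (Subsingleton.elim _ _)
  obtain ⟨Φ, hΦ, hsub, hadd, hnorm⟩ := exists_coordinates hv
  set D : ℝ → Set (ℝ × (Fin n → ℝ)) := fun ρ => {p | p.1 ^ 2 + ∑ i, p.2 i ^ 2 < ρ ^ 2} with hD
  have hball : ∀ ρ, 0 ≤ ρ → Metric.ball 0 ρ = Φ ⁻¹' D ρ := by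
    intro ρ hρ
    ext x
    rw [mem_ball_zero_iff, Set.mem_preimage]
    change _ ↔ _ < ρ ^ 2
    rw [← hnorm, sq_lt_sq₀ (norm_nonneg _) hρ]
  have hDs : ∀ ρ w, slice (D ρ) w =
      centered (ENNReal.ofReal (2 * Real.sqrt (ρ ^ 2 - ∑ i, w i ^ 2))) := by
    intro ρ w
    ext s
    rw [mem_centered_ofReal, mul_lt_mul_iff_right₀ two_pos, Real.lt_sqrt (abs_nonneg s), sq_abs,
      lt_sub_iff_add_lt]
    rfl
  have hDm : ∀ ρ, MeasurableSet (D ρ) := fun ρ =>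
    measurableSet_lt (by fun_prop) measurable_const
  have himage : ∀ E : Set (EuclideanSpace ℝ (Fin (n + 1))), Φ ⁻¹' (Φ '' E) = E := fun E =>
    Φ.injective.preimage_image E
  have hvol : ∀ E, volume (Φ '' E) = volume E := fun E => by
    rw [← hΦ.measure_preimage_equiv, himage]
  have himage_sub : ∀ E R, 0 ≤ R → E ⊆ Metric.ball 0 R → Φ '' E ⊆ D R := by
    intro E R hR h
    rw [hball R hR] at h
    exact Set.image_subset_iff.2 h
  have hfin : ∀ E R, 0 ≤ R → E ⊆ Metric.ball 0 R → ∀ w, volume (slice (Φ '' E) w) ≠ ⊤ := by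
    intro E R hR h w
    refine ne_top_of_le_ne_top ?_ (measure_mono (Set.preimage_mono (himage_sub E R hR h)))
    change volume (slice (D R) w) ≠ ⊤
    rw [hDs, volume_centered]
    exact ENNReal.ofReal_ne_top
  have hint : ∀ E F A, MeasurableSet E → MeasurableSet F → MeasurableSet A →
      interaction (Φ ⁻¹' E) (Φ ⁻¹' F) (Φ ⁻¹' A) = interaction E F A := by
    intro E F A hE hF hA
    have h := (hΦ.prod hΦ).measure_preimage (measurableSet_pairs hE hF hA).nullMeasurableSet
    refine Eq.trans ?_ h
    refine congrArg volume ?_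
    ext p
    simp [pairs, hsub]
  refine ⟨fun E => Φ ⁻¹' steiner (Φ '' E), ?_, ?_, ?_, ?_⟩
  · intro E hE
    have hE' := Φ.measurableSet_image.2 hE
    exact ⟨Φ.measurable (measurableSet_steiner hE'), by
      rw [hΦ.measure_preimage_equiv, volume_steiner hE', hvol]⟩
  · intro E R hR h
    have := steiner_subset (hDs R) (himage_sub E R hR h)
    rw [hball R hR]
    exact Set.preimage_mono this
  · intro E ρ hE hρ
    have hE' := Φ.measurableSet_image.2 hE
    have := volume_inter_add_le_volume_steiner_inter hE' (hDm ρ) (hDs ρ) ‖v‖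
    rw [← hΦ.measure_preimage_equiv, ← hΦ.measure_preimage_equiv,
      ← hΦ.measure_preimage_equiv] at this
    convert this using 3
    · rw [Set.preimage_inter, himage, hball ρ hρ]
    · ext x
      rw [Set.preimage_inter, Set.preimage_sdiff, himage, hball ρ hρ]
      refine and_congr Iff.rfl ?_
      change Φ (x + v) ∈ D ρ ∧ _ ↔ _ ∧ ((Φ x).1 + ‖v‖, (Φ x).2) ∉ Φ '' E
      rw [← hadd, Φ.injective.mem_set_image]
    · rw [Set.preimage_inter, hball ρ hρ]
  · intro E A R hE hA hR hER hAR
    have hE' := Φ.measurableSet_image.2 hE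
    have hA' := Φ.measurableSet_image.2 hA
    have h := interaction_le_steiner hE' hE' hA' (hfin E R hR hER) (hfin E R hR hER)
      (hfin A R hR hAR)
    rwa [← hint _ _ _ hE' hE' hA', himage, himage, ← hint _ _ _ (measurableSet_steiner hE')
      (measurableSet_steiner hE') (measurableSet_steiner hA')] at h

/-! ### Convergence to balls and Riesz's inequality in Euclidean space -/

variable {N : ℕ}

/-- Averaging over all translations `v`, some `v` moves a definite part of `P` into `Q`. -/
theorem exists_translation {P Q : Set (EuclideanSpace ℝ (Fin N))} {R : ℝ}
    (hP : MeasurableSet P) (hQ : MeasurableSet Q) (hPR : P ⊆ Metric.ball 0 R)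
    (hQR : Q ⊆ Metric.ball 0 R) (hPQ : Disjoint P Q) (hP0 : volume P ≠ 0) (hQ0 : volume Q ≠ 0) :
    ∃ v : EuclideanSpace ℝ (Fin N), v ≠ 0 ∧ volume P * volume Q ≤
      2 * volume (Metric.ball (0 : EuclideanSpace ℝ (Fin N)) (2 * R)) *
        volume (P ∩ {x | x + v ∈ Q}) := by
  set V := volume (Metric.ball (0 : EuclideanSpace ℝ (Fin N)) (2 * R)) with hV
  have hR : 0 < R := by
    obtain ⟨x, hx⟩ := nonempty_of_measure_ne_zero hP0
    exact Metric.pos_of_mem_ball (hPR hx)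
  have hVf : V ≠ ⊤ := measure_ball_lt_top.ne
  have hV0 : V ≠ 0 := (Metric.measure_ball_pos _ _ (by positivity)).ne'
  have hPf : volume P ≠ ⊤ := ne_top_of_le_ne_top measure_ball_lt_top.ne (measure_mono hPR)
  have hQf : volume Q ≠ ⊤ := ne_top_of_le_ne_top measure_ball_lt_top.ne (measure_mono hQR)
  have hint : ∫⁻ v, volume (P ∩ {x | x + v ∈ Q}) = volume P * volume Q := by
    have hψ := measurePreserving_prod_add (volume : Measure (EuclideanSpace ℝ (Fin N)))
      (volume : Measure (EuclideanSpace ℝ (Fin N)))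
    rw [← Measure.prod_prod, ← hψ.measure_preimage (hP.prod hQ).nullMeasurableSet,
      Measure.prod_apply_symm (hψ.measurable (hP.prod hQ))]
    rfl
  by_contra! hcon
  have hle : ∀ v, 2 * V * volume (P ∩ {x | x + v ∈ Q}) ≤
      (Metric.ball (0 : EuclideanSpace ℝ (Fin N)) (2 * R)).indicator
        (fun _ => volume P * volume Q) v := by
    intro v
    by_cases hv : v ∈ Metric.ball (0 : EuclideanSpace ℝ (Fin N)) (2 * R)
    · rw [Set.indicator_of_mem hv]
      by_cases hv0 : v = 0
      · have : P ∩ {x | x + v ∈ Q} = ∅ := by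
          ext x
          simp only [hv0, add_zero, Set.mem_inter_iff, Set.mem_empty_iff_false, iff_false]
          exact fun h => Set.disjoint_left.1 hPQ h.1 h.2
        rw [this]; simp
      · exact (hcon v hv0).le
    · have : P ∩ {x | x + v ∈ Q} = ∅ := by
        ext x
        simp only [Set.mem_inter_iff, Set.mem_empty_iff_false, iff_false]
        rintro ⟨h1, h2⟩
        have h1' := mem_ball_zero_iff.1 (hPR h1)
        have h2' := mem_ball_zero_iff.1 (hQR h2)
        refine hv (mem_ball_zero_iff.2 ?_)
        calc ‖v‖ = ‖(x + v) - x‖ := by simp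
          _ ≤ ‖x + v‖ + ‖x‖ := norm_sub_le _ _
          _ < 2 * R := by linarith
      rw [this]; simp
  have h := lintegral_mono hle (μ := volume)
  rw [lintegral_const_mul' _ _ (ENNReal.mul_ne_top (by simp) hVf), hint,
    lintegral_indicator measurableSet_ball, setLIntegral_const, ← hV] at h
  have hM0 : V * (volume P * volume Q) ≠ 0 := mul_ne_zero hV0 (mul_ne_zero hP0 hQ0)
  have hMf : V * (volume P * volume Q) ≠ ⊤ := ENNReal.mul_ne_top hVf (ENNReal.mul_ne_top hPf hQf)
  rw [mul_assoc, mul_comm (volume P * volume Q) V, two_mul] at h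
  exact absurd h (not_le.2 (ENNReal.lt_add_right hMf hM0))

/-- Iterated symmetrization brings two bounded sets simultaneously close to balls, without
decreasing the interaction. -/
theorem exists_near_balls {E A : Set (EuclideanSpace ℝ (Fin N))} {R ρ σ : ℝ}
    (hE : MeasurableSet E) (hA : MeasurableSet A) (hER : E ⊆ Metric.ball 0 R)
    (hAR : A ⊆ Metric.ball 0 R) (hρ : 0 ≤ ρ) (hσ : 0 ≤ σ) (hρR : ρ ≤ R) (hσR : σ ≤ R)
    (hEρ : volume E = volume (Metric.ball (0 : EuclideanSpace ℝ (Fin N)) ρ))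
    (hAσ : volume A = volume (Metric.ball (0 : EuclideanSpace ℝ (Fin N)) σ))
    {ε : ℝ} (hε : 0 < ε) :
    ∃ E' A' : Set (EuclideanSpace ℝ (Fin N)), MeasurableSet E' ∧ MeasurableSet A' ∧
      volume E' = volume E ∧ volume A' = volume A ∧ interaction E E A ≤ interaction E' E' A' ∧
      volume.real (E' \ Metric.ball 0 ρ) + volume.real (A' \ Metric.ball 0 σ) < ε := by
  set adm : Set (EuclideanSpace ℝ (Fin N)) → Set (EuclideanSpace ℝ (Fin N)) → Prop :=
    fun E' A' => MeasurableSet E' ∧ MeasurableSet A' ∧ volume E' = volume E ∧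
      volume A' = volume A ∧ interaction E E A ≤ interaction E' E' A' ∧
      E' ⊆ Metric.ball 0 R ∧ A' ⊆ Metric.ball 0 R with hadm
  set d : Set (EuclideanSpace ℝ (Fin N)) → ℝ → ℝ := fun F r => volume.real (F \ Metric.ball 0 r)
    with hd
  set D : Set ℝ := {x | ∃ E' A', adm E' A' ∧ x = d E' ρ + d A' σ} with hD
  have hDne : D.Nonempty := ⟨_, E, A, ⟨hE, hA, rfl, rfl, le_rfl, hER, hAR⟩, rfl⟩
  have hDb : BddBelow D := ⟨0, by rintro _ ⟨E', A', -, rfl⟩; positivity⟩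
  by_contra! hcon
  set m := sInf D with hm
  have hm0 : 0 < m := by
    refine hε.trans_le (le_csInf hDne ?_)
    rintro _ ⟨E', A', ⟨h1, h2, h3, h4, h5, -, -⟩, rfl⟩
    exact hcon E' A' h1 h2 h3 h4 h5
  set V := volume.real (Metric.ball (0 : EuclideanSpace ℝ (Fin N)) (2 * R)) with hV
  have hfin : ∀ {F : Set (EuclideanSpace ℝ (Fin N))}, F ⊆ Metric.ball 0 R → volume F ≠ ⊤ :=
    fun h => ne_top_of_le_ne_top measure_ball_lt_top.ne (measure_mono h)
  -- Symmetrization decreases the distance to the ball by the measure of the translated part.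
  have hstep : ∀ {v : EuclideanSpace ℝ (Fin N)} {S} {F : Set (EuclideanSpace ℝ (Fin N))} {r : ℝ},
      F ⊆ Metric.ball 0 R → S ⊆ Metric.ball 0 R → MeasurableSet F → MeasurableSet S →
      volume S = volume F →
      volume (F ∩ Metric.ball 0 r) + volume ((F \ Metric.ball 0 r) ∩
          {x | x + v ∈ Metric.ball 0 r \ F}) ≤ volume (S ∩ Metric.ball 0 r) →
      d S r + volume.real ((F \ Metric.ball 0 r) ∩ {x | x + v ∈ Metric.ball 0 r \ F}) ≤ d F r := by
    intro v S F r hFR hSR hF hS hSF h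
    have e1 := measureReal_inter_add_sdiff (μ := volume) (s := F) (t := Metric.ball 0 r)
      measurableSet_ball (hfin hFR)
    have e2 := measureReal_inter_add_sdiff (μ := volume) (s := S) (t := Metric.ball 0 r)
      measurableSet_ball (hfin hSR)
    have e3 : volume.real S = volume.real F := by rw [measureReal_def, hSF, measureReal_def]
    have f1 : volume (F ∩ Metric.ball 0 r) ≠ ⊤ := hfin (Set.inter_subset_left.trans hFR)
    have f2 : volume ((F \ Metric.ball 0 r) ∩ {x | x + v ∈ Metric.ball 0 r \ F}) ≠ ⊤ :=
      hfin ((Set.inter_subset_left.trans Set.sdiff_subset).trans hFR)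
    have f3 : volume (S ∩ Metric.ball 0 r) ≠ ⊤ := hfin (Set.inter_subset_left.trans hSR)
    have := ENNReal.toReal_mono f3 h
    rw [ENNReal.toReal_add f1 f2] at this
    simp only [← measureReal_def] at this
    simp only [hd]
    linarith
  -- A set at distance `m / 2` or more from its ball admits a direction with a definite gain.
  have hgain : ∀ {F : Set (EuclideanSpace ℝ (Fin N))} {r : ℝ}, MeasurableSet F →
      F ⊆ Metric.ball 0 R → r ≤ R →
      volume F = volume (Metric.ball (0 : EuclideanSpace ℝ (Fin N)) r) → m / 2 ≤ d F r →
      ∃ v : EuclideanSpace ℝ (Fin N), v ≠ 0 ∧ (m / 2) ^ 2 ≤ 2 * V *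
        volume.real ((F \ Metric.ball 0 r) ∩ {x | x + v ∈ Metric.ball 0 r \ F}) := by
    intro F r hF hFR hr hFr hdF
    have hBR : Metric.ball (0 : EuclideanSpace ℝ (Fin N)) r ⊆ Metric.ball 0 R :=
      Metric.ball_subset_ball hr
    have e : volume (F \ Metric.ball 0 r) = volume (Metric.ball 0 r \ F) := by
      have e1 := measure_inter_add_sdiff (μ := volume) F (t := Metric.ball 0 r) measurableSet_ball
      have e2 := measure_inter_add_sdiff (μ := volume) (Metric.ball 0 r) (t := F) hF
      rw [Set.inter_comm] at e2
      rw [hFr, ← e2] at e1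
      exact (ENNReal.add_right_inj (hfin (Set.inter_subset_left.trans hFR))).1 e1
    have h0 : volume (F \ Metric.ball 0 r) ≠ 0 := by
      intro h0
      have : d F r = 0 := by simp only [hd]; rw [measureReal_def, h0]; simp
      linarith
    obtain ⟨v, hv, hle⟩ := exists_translation (hF.diff measurableSet_ball)
      (measurableSet_ball.diff hF) (Set.sdiff_subset.trans hFR) (Set.sdiff_subset.trans hBR)
      (Set.disjoint_left.2 fun x h1 h2 => h1.2 h2.1) h0 (e ▸ h0)
    refine ⟨v, hv, ?_⟩
    have := ENNReal.toReal_mono (ENNReal.mul_ne_top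
      (ENNReal.mul_ne_top (by simp) measure_ball_lt_top.ne)
      (hfin ((Set.inter_subset_left.trans Set.sdiff_subset).trans hFR))) hle
    rw [← e, ENNReal.toReal_mul, ENNReal.toReal_mul, ENNReal.toReal_mul] at this
    simp only [← measureReal_def, ENNReal.toReal_ofNat] at this
    refine le_trans ?_ this
    rw [← sq]
    exact pow_le_pow_left₀ (by positivity) hdF 2
  have hR0 : 0 ≤ R := hρ.trans hρR
  have himprove : ∀ {E' A'}, adm E' A' → ∃ E'' A'', adm E'' A'' ∧
      2 * V * (d E'' ρ + d A'' σ) + (m / 2) ^ 2 ≤ 2 * V * (d E' ρ + d A' σ) := by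
    rintro E' A' ⟨h1, h2, h3, h4, h5, h6, h7⟩
    have hsum : m ≤ d E' ρ + d A' σ :=
      csInf_le hDb ⟨E', A', ⟨h1, h2, h3, h4, h5, h6, h7⟩, rfl⟩
    have hV0 : 0 ≤ V := measureReal_nonneg
    obtain ⟨v, hv, hor⟩ : ∃ v : EuclideanSpace ℝ (Fin N), v ≠ 0 ∧
        (m / 2) ^ 2 ≤ 2 * V *
          (volume.real ((E' \ Metric.ball 0 ρ) ∩ {x | x + v ∈ Metric.ball 0 ρ \ E'}) +
          volume.real ((A' \ Metric.ball 0 σ) ∩ {x | x + v ∈ Metric.ball 0 σ \ A'})) := by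
      rcases le_or_gt (m / 2) (d E' ρ) with h | h
      · obtain ⟨v, hv, hle⟩ := hgain h1 h6 hρR (h3.trans hEρ) h
        exact ⟨v, hv, hle.trans (mul_le_mul_of_nonneg_left
          (le_add_of_nonneg_right measureReal_nonneg) (by positivity))⟩
      · obtain ⟨v, hv, hle⟩ := hgain h2 h7 hσR (h4.trans hAσ) (by linarith)
        exact ⟨v, hv, hle.trans (mul_le_mul_of_nonneg_left
          (le_add_of_nonneg_left measureReal_nonneg) (by positivity))⟩
    obtain ⟨S, hS1, hS2, hS3, hS4⟩ := exists_symmetrization hv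
    refine ⟨S E', S A', ⟨(hS1 E' h1).1, (hS1 A' h2).1, (hS1 E' h1).2.trans h3,
      (hS1 A' h2).2.trans h4, h5.trans (hS4 E' A' R h1 h2 hR0 h6 h7), hS2 E' R hR0 h6,
      hS2 A' R hR0 h7⟩, ?_⟩
    have g1 := hstep h6 (hS2 E' R hR0 h6) h1 (hS1 E' h1).1 (hS1 E' h1).2 (hS3 E' ρ h1 hρ)
    have g2 := hstep h7 (hS2 A' R hR0 h7) h2 (hS1 A' h2).1 (hS1 A' h2).2 (hS3 A' σ h2 hσ)
    have g3 := mul_le_mul_of_nonneg_left (add_le_add g1 g2) (by positivity : 0 ≤ 2 * V)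
    linarith
  obtain ⟨x, ⟨E', A', hadm', rfl⟩, hlt⟩ := exists_lt_of_csInf_lt hDne
    (show sInf D < m + (m / 2) ^ 2 / (2 * V + 1) by
      rw [← hm]; exact lt_add_of_pos_right _ (by positivity))
  obtain ⟨E'', A'', hadm'', hle⟩ := himprove hadm'
  have hge : m ≤ d E'' ρ + d A'' σ := csInf_le hDb ⟨E'', A'', hadm'', rfl⟩
  have hV0 : 0 ≤ V := measureReal_nonneg
  have h1 : 2 * V * (d E' ρ + d A' σ) ≤ 2 * V * (m + (m / 2) ^ 2 / (2 * V + 1)) :=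
    mul_le_mul_of_nonneg_left hlt.le (by positivity)
  have h2 : 2 * V * m ≤ 2 * V * (d E'' ρ + d A'' σ) :=
    mul_le_mul_of_nonneg_left hge (by positivity)
  have h3 : 2 * V * ((m / 2) ^ 2 / (2 * V + 1)) < (m / 2) ^ 2 := by
    rw [← mul_div_assoc, div_lt_iff₀ (by positivity)]
    nlinarith [sq_pos_of_pos (half_pos hm0)]
  linarith

theorem interaction_le_ball_of_subset_ball {E A : Set (EuclideanSpace ℝ (Fin N))} {R ρ σ : ℝ}
    (hE : MeasurableSet E) (hA : MeasurableSet A) (hER : E ⊆ Metric.ball 0 R)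
    (hAR : A ⊆ Metric.ball 0 R) (hρ : 0 ≤ ρ) (hσ : 0 ≤ σ)
    (hEρ : volume E = volume (Metric.ball (0 : EuclideanSpace ℝ (Fin N)) ρ))
    (hAσ : volume A = volume (Metric.ball (0 : EuclideanSpace ℝ (Fin N)) σ)) :
    interaction E E A ≤ interaction (Metric.ball (0 : EuclideanSpace ℝ (Fin N)) ρ)
      (Metric.ball 0 ρ) (Metric.ball 0 σ) := by
  set R' := max R (max ρ σ) with hR'
  have hEf : volume E ≠ ⊤ := hEρ ▸ measure_ball_lt_top.ne
  have hAf : volume A ≠ ⊤ := hAσ ▸ measure_ball_lt_top.ne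
  refine ENNReal.le_of_forall_pos_le_add fun δ hδ _ => ?_
  set e := volume.real E with he
  have he0 : 0 ≤ e := measureReal_nonneg
  obtain ⟨E', A', h1, h2, h3, h4, h5, h6⟩ := exists_near_balls (R := R') hE hA
    (hER.trans (Metric.ball_subset_ball (le_max_left _ _)))
    (hAR.trans (Metric.ball_subset_ball (le_max_left _ _))) hρ hσ
    ((le_max_left _ _).trans (le_max_right _ _)) ((le_max_right _ _).trans (le_max_right _ _))
    hEρ hAσ (ε := δ / (2 * e + 1)) (by positivity)
  refine h5.trans ?_
  have hsub : pairs E' E' A' ⊆ pairs (Metric.ball 0 ρ) (Metric.ball 0 ρ) (Metric.ball 0 σ) ∪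
      ((E' \ Metric.ball 0 ρ) ×ˢ E' ∪ E' ×ˢ (E' \ Metric.ball 0 ρ) ∪
        pairs E' Set.univ (A' \ Metric.ball 0 σ)) := by
    rintro ⟨x, y⟩ ⟨hx, hy, hxy⟩
    by_cases hx' : x ∈ Metric.ball 0 ρ
    · by_cases hy' : y ∈ Metric.ball 0 ρ
      · by_cases hxy' : x - y ∈ Metric.ball 0 σ
        · exact Or.inl ⟨hx', hy', hxy'⟩
        · exact Or.inr (Or.inr ⟨hx, trivial, hxy, hxy'⟩)
      · exact Or.inr (Or.inl (Or.inr ⟨hx, hy, hy'⟩))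
    · exact Or.inr (Or.inl (Or.inl ⟨⟨hx, hx'⟩, hy⟩))
  have hbound : volume (E' \ Metric.ball 0 ρ) * volume E' +
      volume E' * volume (E' \ Metric.ball 0 ρ) +
      volume E' * volume (A' \ Metric.ball 0 σ) ≤ δ := by
    rw [h3]
    have f1 : volume (E' \ Metric.ball 0 ρ) ≠ ⊤ :=
      ne_top_of_le_ne_top (h3 ▸ hEf) (measure_mono Set.sdiff_subset)
    have f2 : volume (A' \ Metric.ball 0 σ) ≠ ⊤ :=
      ne_top_of_le_ne_top (h4 ▸ hAf) (measure_mono Set.sdiff_subset)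
    rw [← ofReal_measureReal hEf, ← ofReal_measureReal f1, ← ofReal_measureReal f2, ← he]
    rw [← ENNReal.ofReal_mul measureReal_nonneg, ← ENNReal.ofReal_mul he0, ← ENNReal.ofReal_mul he0,
      ← ENNReal.ofReal_add (by positivity) (by positivity),
      ← ENNReal.ofReal_add (by positivity) (by positivity), ← ENNReal.ofReal_coe_nnreal]
    refine ENNReal.ofReal_le_ofReal ?_
    set x := volume.real (E' \ Metric.ball 0 ρ)
    set y := volume.real (A' \ Metric.ball 0 σ)
    have hx : 0 ≤ x := measureReal_nonneg
    have hy : 0 ≤ y := measureReal_nonneg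
    rw [lt_div_iff₀ (by positivity)] at h6
    nlinarith [mul_nonneg hy he0]
  calc interaction E' E' A'
      ≤ interaction (Metric.ball (0 : EuclideanSpace ℝ (Fin N)) ρ)
          (Metric.ball 0 ρ) (Metric.ball 0 σ) +
        (volume ((E' \ Metric.ball 0 ρ) ×ˢ E') + volume (E' ×ˢ (E' \ Metric.ball 0 ρ)) +
          interaction E' Set.univ (A' \ Metric.ball 0 σ)) :=
        (measure_mono hsub).trans <| (measure_union_le _ _).trans <| add_le_add le_rfl <|
          (measure_union_le _ _).trans <| add_le_add (measure_union_le _ _) le_rfl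
    _ ≤ _ := by
      refine add_le_add le_rfl (le_trans ?_ hbound)
      rw [show (volume : Measure (EuclideanSpace ℝ (Fin N) × EuclideanSpace ℝ (Fin N))) =
        (volume : Measure (EuclideanSpace ℝ (Fin N))).prod volume from rfl,
        Measure.prod_prod, Measure.prod_prod]
      exact add_le_add le_rfl (interaction_le_mul_left h1 (h2.diff measurableSet_ball))

theorem ballOfVolume_mono {m m' : ℝ≥0∞} (h : m ≤ m') :
    ballOfVolume N m ⊆ ballOfVolume N m' :=
  Metric.eball_subset_eball (by gcongr)

theorem measurableSet_ballOfVolume (m : ℝ≥0∞) : MeasurableSet (ballOfVolume N m) :=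
  Metric.isOpen_eball.measurableSet

theorem exists_ballOfVolume_eq_ball {m : ℝ≥0∞} (hm : m ≠ ⊤) :
    ∃ ρ, 0 ≤ ρ ∧ ballOfVolume N m = Metric.ball 0 ρ := by
  have hpos := Metric.measure_ball_pos volume (0 : EuclideanSpace ℝ (Fin N)) one_pos
  have hne : (m / volume (Metric.ball (0 : EuclideanSpace ℝ (Fin N)) 1)) ^ ((1 : ℝ) / N) ≠ ⊤ :=
    ENNReal.rpow_ne_top_of_nonneg (by positivity) (ENNReal.div_ne_top hm hpos.ne')
  refine ⟨((m / volume (Metric.ball (0 : EuclideanSpace ℝ (Fin N)) 1)) ^ ((1 : ℝ) / N)).toReal,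
    ENNReal.toReal_nonneg, ?_⟩
  rw [← Metric.eball_ofReal, ENNReal.ofReal_toReal hne]
  rfl

theorem volume_ballOfVolume (hN : N ≠ 0) {m : ℝ≥0∞} (hm : m ≠ ⊤) :
    volume (ballOfVolume N m) = m := by
  have : Nonempty (Fin N) := ⟨⟨0, Nat.pos_of_ne_zero hN⟩⟩
  have hpos := Metric.measure_ball_pos volume (0 : EuclideanSpace ℝ (Fin N)) one_pos
  have hfin : volume (Metric.ball (0 : EuclideanSpace ℝ (Fin N)) 1) ≠ ⊤ := measure_ball_lt_top.ne
  have hne : (m / volume (Metric.ball (0 : EuclideanSpace ℝ (Fin N)) 1)) ^ ((1 : ℝ) / N) ≠ ⊤ :=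
    ENNReal.rpow_ne_top_of_nonneg (by positivity) (ENNReal.div_ne_top hm hpos.ne')
  rw [ballOfVolume, ← ENNReal.ofReal_toReal hne, Metric.eball_ofReal,
    Measure.addHaar_ball _ _ ENNReal.toReal_nonneg, ENNReal.ofReal_pow ENNReal.toReal_nonneg,
    ENNReal.ofReal_toReal hne, ← ENNReal.rpow_natCast, ← ENNReal.rpow_mul, finrank_euclideanSpace,
    Fintype.card_fin, one_div_mul_cancel (by exact_mod_cast hN), ENNReal.rpow_one,
    ENNReal.div_mul_cancel hpos.ne' hfin]

/-- **Riesz's rearrangement inequality** in Euclidean space, for the sets `E`, `E`, `A` of finite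
measure. -/
theorem interaction_le_ballOfVolume (hN : N ≠ 0) {E A : Set (EuclideanSpace ℝ (Fin N))}
    (hE : MeasurableSet E) (hA : MeasurableSet A) (hEf : volume E ≠ ⊤) (hAf : volume A ≠ ⊤) :
    interaction E E A ≤ interaction (ballOfVolume N (volume E)) (ballOfVolume N (volume E))
      (ballOfVolume N (volume A)) := by
  set B : ℕ → Set (EuclideanSpace ℝ (Fin N)) := fun n => Metric.ball 0 n with hB
  have hBmono : Monotone B := fun n m h => Metric.ball_subset_ball (by exact_mod_cast h)
  have hunion : pairs E E A = ⋃ n, pairs (E ∩ B n) (E ∩ B n) (A ∩ B n) := by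
    ext ⟨x, y⟩
    simp only [Set.mem_iUnion]
    constructor
    · rintro ⟨hx, hy, hxy⟩
      obtain ⟨n, hn⟩ := exists_nat_gt (max ‖x‖ (max ‖y‖ ‖x - y‖))
      simp only [max_lt_iff] at hn
      exact ⟨n, ⟨hx, mem_ball_zero_iff.2 hn.1⟩, ⟨hy, mem_ball_zero_iff.2 hn.2.1⟩,
        hxy, mem_ball_zero_iff.2 hn.2.2⟩
    · rintro ⟨n, hx, hy, hxy⟩
      exact ⟨hx.1, hy.1, hxy.1⟩
  have hmono : Monotone fun n => pairs (E ∩ B n) (E ∩ B n) (A ∩ B n) := fun n m h =>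
    pairs_mono (Set.inter_subset_inter_right _ (hBmono h))
      (Set.inter_subset_inter_right _ (hBmono h)) (Set.inter_subset_inter_right _ (hBmono h))
  rw [interaction, hunion, hmono.measure_iUnion]
  refine iSup_le fun n => ?_
  have hEn : volume (E ∩ B n) ≠ ⊤ := ne_top_of_le_ne_top hEf (measure_mono Set.inter_subset_left)
  have hAn : volume (A ∩ B n) ≠ ⊤ := ne_top_of_le_ne_top hAf (measure_mono Set.inter_subset_left)
  obtain ⟨ρ, hρ0, hρ⟩ := exists_ballOfVolume_eq_ball (N := N) hEn
  obtain ⟨σ, hσ0, hσ⟩ := exists_ballOfVolume_eq_ball (N := N) hAn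
  calc interaction (E ∩ B n) (E ∩ B n) (A ∩ B n)
      ≤ interaction (ballOfVolume N (volume (E ∩ B n))) (ballOfVolume N (volume (E ∩ B n)))
          (ballOfVolume N (volume (A ∩ B n))) := by
        rw [hρ, hσ]
        refine interaction_le_ball_of_subset_ball (hE.inter measurableSet_ball)
          (hA.inter measurableSet_ball) (R := n) Set.inter_subset_right Set.inter_subset_right
          hρ0 hσ0 ?_ ?_
        · rw [← hρ, volume_ballOfVolume hN hEn]
        · rw [← hσ, volume_ballOfVolume hN hAn]
    _ ≤ _ := by
      have h1 := ballOfVolume_mono (N := N)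
        (measure_mono (μ := volume) (Set.inter_subset_left : E ∩ B n ⊆ E))
      have h2 := ballOfVolume_mono (N := N)
        (measure_mono (μ := volume) (Set.inter_subset_left : A ∩ B n ⊆ A))
      exact interaction_mono h1 h1 h2

/-! ### The nonlocal isoperimetric inequality -/

theorem per_mono_ae {H H' : EuclideanSpace ℝ (Fin N) → ℝ≥0∞} (h : ∀ᵐ z, H z ≤ H' z)
    (E : Set (EuclideanSpace ℝ (Fin N))) : per H E ≤ per H' E := by
  refine lintegral_mono fun x => lintegral_mono_ae (ae_restrict_of_ae ?_)
  exact (Measure.measurePreserving_sub_left volume x).quasiMeasurePreserving.ae h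

theorem interaction_eq_lintegral {E F A : Set (EuclideanSpace ℝ (Fin N))} (hE : MeasurableSet E)
    (hF : MeasurableSet F) (hA : MeasurableSet A) :
    interaction E F A = ∫⁻ x in E, volume (F ∩ {y | x - y ∈ A}) := by
  rw [interaction, show (volume : Measure (EuclideanSpace ℝ (Fin N) × EuclideanSpace ℝ (Fin N))) =
    (volume : Measure (EuclideanSpace ℝ (Fin N))).prod volume from rfl,
    Measure.prod_apply (measurableSet_pairs hE hF hA), ← lintegral_indicator hE]
  refine lintegral_congr fun x => ?_
  by_cases hx : x ∈ E
  · rw [Set.indicator_of_mem hx]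
    congr 1
    ext y
    exact ⟨fun h => h.2, fun h => ⟨hx, h⟩⟩
  · rw [Set.indicator_of_notMem hx]
    exact measure_mono_null (fun y hy => hx hy.1) measure_empty

theorem per_indicator {E A : Set (EuclideanSpace ℝ (Fin N))} (hE : MeasurableSet E)
    (hA : MeasurableSet A) : per (A.indicator fun _ => 1) E = interaction E Eᶜ A := by
  rw [interaction_eq_lintegral hE hE.compl hA]
  refine lintegral_congr fun x => ?_
  have hm : MeasurableSet {y | x - y ∈ A} := measurable_const.sub measurable_id hA
  calc _ = ∫⁻ y in Eᶜ, {y | x - y ∈ A}.indicator (fun _ => 1) y := rfl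
    _ = _ := by
      rw [lintegral_indicator hm, setLIntegral_one, Measure.restrict_apply hm, Set.inter_comm]

theorem per_indicator_add_interaction {E A : Set (EuclideanSpace ℝ (Fin N))}
    (hE : MeasurableSet E) (hA : MeasurableSet A) :
    per (A.indicator fun _ => 1) E + interaction E E A = volume E * volume A := by
  have hm : ∀ x, MeasurableSet {y | x - y ∈ A} := fun x => measurable_const.sub measurable_id hA
  rw [per_indicator hE hA, interaction, interaction, ← measure_union _
    (measurableSet_pairs hE hE hA)]
  · have : pairs E Eᶜ A ∪ pairs E E A = pairs E Set.univ A := by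
      ext p
      simp only [pairs, Set.mem_union]
      constructor
      · rintro (h | h)
        · exact ⟨h.1, trivial, h.2.2⟩
        · exact ⟨h.1, trivial, h.2.2⟩
      · rintro ⟨h1, -, h3⟩
        by_cases h2 : p.2 ∈ E
        · exact Or.inr ⟨h1, h2, h3⟩
        · exact Or.inl ⟨h1, h2, h3⟩
    rw [this, ← interaction, interaction_eq_lintegral hE MeasurableSet.univ hA]
    simp only [Set.univ_inter]
    have : ∀ x : EuclideanSpace ℝ (Fin N), volume {y | x - y ∈ A} = volume A := fun x =>
      (Measure.measurePreserving_sub_left volume x).measure_preimage hA.nullMeasurableSet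
    simp only [this, setLIntegral_const, mul_comm]
  · exact Set.disjoint_left.2 fun p h1 h2 => h1.2.1 h2.2.1

/-- The perimeter for a characteristic function as kernel decreases under rearrangement: Riesz's
inequality applied to the complement. -/
theorem per_indicator_ball_le (hN : N ≠ 0) {E A : Set (EuclideanSpace ℝ (Fin N))}
    (hE : MeasurableSet E) (hA : MeasurableSet A) (hEf : volume E ≠ ⊤) (hAf : volume A ≠ ⊤) :
    per ((ballOfVolume N (volume A)).indicator fun _ => 1) (ballOfVolume N (volume E)) ≤
      per (A.indicator fun _ => 1) E := by
  have h1 := per_indicator_add_interaction hE hA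
  have h2 := per_indicator_add_interaction (measurableSet_ballOfVolume (N := N) (volume E))
    (measurableSet_ballOfVolume (volume A))
  rw [volume_ballOfVolume hN hEf, volume_ballOfVolume hN hAf, ← h1] at h2
  have hf : interaction E E A ≠ ⊤ :=
    ne_top_of_le_ne_top (ENNReal.mul_ne_top hEf hEf) (interaction_le_mul _ _ _)
  refine (ENNReal.add_le_add_iff_right hf).1 ?_
  rw [← h2]
  gcongr
  exact interaction_le_ballOfVolume hN hE hA hEf hAf

theorem per_lintegral {h : ℝ → EuclideanSpace ℝ (Fin N) → ℝ≥0∞}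
    (hh : Measurable (Function.uncurry h)) (E : Set (EuclideanSpace ℝ (Fin N))) :
    per (fun x => ∫⁻ t in Set.Ioi 0, h t x) E = ∫⁻ t in Set.Ioi 0, per (h t) E := by
  have hm : Measurable fun q : (EuclideanSpace ℝ (Fin N) × ℝ) × EuclideanSpace ℝ (Fin N) =>
      h q.1.2 (q.1.1 - q.2) :=
    hh.comp (show Measurable fun q : (EuclideanSpace ℝ (Fin N) × ℝ) × EuclideanSpace ℝ (Fin N) =>
      (q.1.2, q.1.1 - q.2) by fun_prop)
  calc per (fun x => ∫⁻ t in Set.Ioi 0, h t x) E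
      = ∫⁻ x in E, ∫⁻ t in Set.Ioi 0, ∫⁻ y in Eᶜ, h t (x - y) := by
        refine lintegral_congr fun x => lintegral_lintegral_swap ?_
        exact (hm.comp (show Measurable fun p : EuclideanSpace ℝ (Fin N) × ℝ =>
          ((x, p.2), p.1) by fun_prop)).aemeasurable
    _ = _ := lintegral_lintegral_swap (hm.lintegral_prod_right').aemeasurable

theorem measurable_uncurry_ball_indicator {β : ℝ → ℝ≥0∞} (hβ : Antitone β) :
    Measurable (Function.uncurry fun t : ℝ => (ballOfVolume N (β t)).indicator
      (fun _ : EuclideanSpace ℝ (Fin N) => (1 : ℝ≥0∞))) := by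
  have hset : MeasurableSet {p : ℝ × EuclideanSpace ℝ (Fin N) | p.2 ∈ ballOfVolume N (β p.1)} := by
    have : Measurable fun t : ℝ =>
        (β t / volume (Metric.ball (0 : EuclideanSpace ℝ (Fin N)) 1)) ^ ((1 : ℝ) / N) :=
      (hβ.measurable.div_const _).pow_const _
    exact measurableSet_lt (f := fun p : ℝ × EuclideanSpace ℝ (Fin N) => edist p.2 0)
      (by fun_prop) (this.comp measurable_fst)
  exact measurable_const.indicator hset

theorem lintegral_superlevel (s : ℝ≥0) :
    ∫⁻ t in Set.Ioi (0 : ℝ), {r : ℝ | r < s}.indicator (fun _ => (1 : ℝ≥0∞)) t = s := by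
  rw [lintegral_indicator (show MeasurableSet {r : ℝ | r < s} from measurableSet_Iio),
    setLIntegral_one,
    Measure.restrict_apply (show MeasurableSet {r : ℝ | r < s} from measurableSet_Iio)]
  have : Set.Iio (s : ℝ) ∩ Set.Ioi 0 = Set.Ioo 0 (s : ℝ) := by
    ext; simp [and_comm]
  change volume (Set.Iio (s : ℝ) ∩ Set.Ioi 0) = _
  rw [this, Real.volume_Ioo]
  simp

theorem rearrangement_congr {K K' : EuclideanSpace ℝ (Fin N) → ℝ≥0} (h : K =ᵐ[volume] K') :
    rearrangement K = rearrangement K' := by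
  have : ∀ t : ℝ, volume {y | t < (K y : ℝ)} = volume {y | t < (K' y : ℝ)} := by
    intro t
    refine measure_congr ?_
    filter_upwards [h] with y hy
    change (t < (K y : ℝ)) = (t < (K' y : ℝ))
    rw [hy]
  ext x
  simp only [rearrangement, this]

/-- Among sets of given finite volume, the ball minimizes the nonlocal perimeter after
rearrangement of the kernel. -/
theorem profile_le_per (hN : N ≠ 0) {K : EuclideanSpace ℝ (Fin N) → ℝ≥0}
    (hK : AEMeasurable K) (hlevel : ∀ t : ℝ, 0 < t → volume {y | t < (K y : ℝ)} ≠ ⊤)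
    {E : Set (EuclideanSpace ℝ (Fin N))} (hE : MeasurableSet E) {m : ℝ≥0} (hm : volume E = m) :
    profile K m ≤ per (fun x => (K x : ℝ≥0∞)) E := by
  set K' := hK.mk K with hK'
  have hae : K =ᵐ[volume] K' := hK.ae_eq_mk
  have hKm : Measurable K' := hK.measurable_mk
  have hlev : ∀ t : ℝ, volume {y | t < (K' y : ℝ)} = volume {y | t < (K y : ℝ)} := by
    intro t
    refine measure_congr ?_
    filter_upwards [hae] with y hy
    change (t < (K' y : ℝ)) = (t < (K y : ℝ))
    rw [hy]
  have hmset : ∀ t : ℝ, MeasurableSet {y | t < (K' y : ℝ)} := fun t =>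
    measurableSet_lt measurable_const (by fun_prop)
  have hanti : Antitone fun t : ℝ => volume {y | t < (K' y : ℝ)} := fun s t hst =>
    measure_mono fun y (hy : t < (K' y : ℝ)) => lt_of_le_of_lt hst hy
  have hlayer : (fun x => (K' x : ℝ≥0∞)) = fun x => ∫⁻ t in Set.Ioi (0 : ℝ),
      {y | t < (K' y : ℝ)}.indicator (fun _ => (1 : ℝ≥0∞)) x := by
    ext x
    rw [← lintegral_superlevel]
    rfl
  have hmeas : Measurable (Function.uncurry fun (t : ℝ) (x : EuclideanSpace ℝ (Fin N)) =>
      {y | t < (K' y : ℝ)}.indicator (fun _ => (1 : ℝ≥0∞)) x) := by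
    have : MeasurableSet {p : ℝ × EuclideanSpace ℝ (Fin N) | p.1 < (K' p.2 : ℝ)} :=
      measurableSet_lt measurable_fst (by fun_prop)
    exact measurable_const.indicator this
  calc profile K m = per (rearrangement K') (ballOfVolume N (volume E)) := by
        rw [hm, ← rearrangement_congr hae]; rfl
    _ = ∫⁻ t in Set.Ioi (0 : ℝ), per ((ballOfVolume N (volume {y | t < (K' y : ℝ)})).indicator
          fun _ => 1) (ballOfVolume N (volume E)) :=
        per_lintegral (measurable_uncurry_ball_indicator hanti) _
    _ ≤ ∫⁻ t in Set.Ioi (0 : ℝ), per ({y | t < (K' y : ℝ)}.indicator fun _ => 1) E := by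
        refine setLIntegral_mono' measurableSet_Ioi fun t ht => ?_
        exact per_indicator_ball_le hN hE (hmset t) (by simp [hm]) (hlev t ▸ hlevel t ht)
    _ = per (fun x => (K' x : ℝ≥0∞)) E := by rw [hlayer, per_lintegral hmeas]
    _ ≤ _ := per_mono_ae (hae.mono fun z hz => by rw [hz]) E

theorem IsKernel.aemeasurable (hN : N ≠ 0) {K : EuclideanSpace ℝ (Fin N) → ℝ≥0}
    (hK : IsKernel K) : AEMeasurable K := by
  have : Nonempty (Fin N) := ⟨⟨0, Nat.pos_of_ne_zero hN⟩⟩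
  have h : AEMeasurable fun x => Real.toNNReal ((min ‖x‖ 1)⁻¹ * (min ‖x‖ 1 * (K x : ℝ))) :=
    ((by fun_prop : Measurable fun x : EuclideanSpace ℝ (Fin N) => (min ‖x‖ 1)⁻¹).aemeasurable.mul
      hK.integrable.aestronglyMeasurable.aemeasurable).real_toNNReal
  refine h.congr ?_
  have h0 : ∀ᵐ x : EuclideanSpace ℝ (Fin N), x ≠ 0 := Measure.ae_ne volume 0
  filter_upwards [h0] with x hx
  have : min ‖x‖ 1 ≠ 0 := (lt_min (norm_pos_iff.2 hx) one_pos).ne'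
  rw [inv_mul_cancel_left₀ this, Real.toNNReal_coe]

theorem IsKernel.volume_superlevel_ne_top {K : EuclideanSpace ℝ (Fin N) → ℝ≥0}
    (hK : IsKernel K) {t : ℝ} (ht : 0 < t) : volume {y | t < (K y : ℝ)} ≠ ⊤ := by
  have h1 := hK.integrable.measure_gt_lt_top ht
  refine ne_top_of_le_ne_top (ENNReal.add_ne_top.2 ⟨h1.ne,
    (measure_ball_lt_top (μ := volume) (x := (0 : EuclideanSpace ℝ (Fin N))) (r := 1)).ne⟩)
    ((measure_mono ?_).trans (measure_union_le _ _))
  intro y (hy : t < (K y : ℝ))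
  by_cases h : ‖y‖ < 1
  · exact Or.inr (mem_ball_zero_iff.2 h)
  · left
    change t < min ‖y‖ 1 * (K y : ℝ)
    rwa [min_eq_right (not_lt.1 h), one_mul]

/-! ### Sets of finite perimeter on a fine grid -/

theorem iff_of_forall_iff_succ {p : ℤ → Prop} (h : ∀ z, p z ↔ p (z + 1)) (z z' : ℤ) :
    p z ↔ p z' := by
  have h0 : ∀ z, p z ↔ p 0 := by
    intro z
    induction z using Int.induction_on with
    | zero => rfl
    | succ i ih => rw [← h, ih]
    | pred i ih => rw [h, sub_add_cancel, ih]
  rw [h0 z, h0 z']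

theorem exists_bound_of_finite {s : Set (Fin N → ℤ)} (hs : s.Finite) :
    ∃ M : ℤ, 0 ≤ M ∧ ∀ k ∈ s, ∀ j, |k j| ≤ M := by
  obtain ⟨M, hM⟩ := (hs.image fun k => ∑ j, |k j|).bddAbove
  refine ⟨max M 0, le_max_right _ _, fun k hk j => le_max_of_le_left ?_⟩
  exact (Finset.single_le_sum (f := fun j => |k j|) (fun i _ => abs_nonneg _)
    (Finset.mem_univ j)).trans (hM ⟨k, hk, rfl⟩)

/-- A subset of the lattice with finite edge boundary is constant outside a box along each line
that misses the box. -/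
theorem exists_bound_edge {b : (Fin N → ℤ) → Prop}
    (hb : ∀ i, {k | ¬ (b k ↔ b (k + Pi.single i 1))}.Finite) :
    ∃ M : ℤ, 0 ≤ M ∧ ∀ k i, (∃ j, M < |k j|) → (b k ↔ b (k + Pi.single i 1)) := by
  obtain ⟨M, hM0, hM⟩ := exists_bound_of_finite (Set.finite_iUnion hb)
  refine ⟨M, hM0, fun k i ⟨j, hj⟩ => ?_⟩
  by_contra h
  exact absurd (hM k (Set.mem_iUnion.2 ⟨i, h⟩) j) (not_le.2 hj)

theorem finite_box (M : ℤ) : {k : Fin N → ℤ | ∀ j, |k j| ≤ M}.Finite := by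
  refine (Set.finite_Icc (fun _ => -M) (fun _ => M)).subset fun k hk => ?_
  exact ⟨fun j => (abs_le.1 (hk j)).1, fun j => (abs_le.1 (hk j)).2⟩

/-- In dimension at least two, the complement of a box in the lattice is connected, so a subset of
the lattice with finite edge boundary is finite or cofinite. -/
theorem finite_or_cofinite_of_two_le (hN : 2 ≤ N) {b : (Fin N → ℤ) → Prop}
    (hb : ∀ i, {k | ¬ (b k ↔ b (k + Pi.single i 1))}.Finite) :
    {k | b k}.Finite ∨ {k | ¬ b k}.Finite := by
  obtain ⟨M, hM0, hM⟩ := exists_bound_edge hb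
  have hupd : ∀ (k : Fin N → ℤ) (i j : Fin N), i ≠ j → M < |k j| → ∀ z,
      (b k ↔ b (Function.update k i z)) := by
    intro k i j hij hj z
    have := iff_of_forall_iff_succ (p := fun z => b (Function.update k i z)) (fun z => ?_) (k i) z
    · simpa using this
    · have e : Function.update k i (z + 1) = Function.update k i z + Pi.single i 1 := by
        ext l
        by_cases h : l = i
        · subst h; simp
        · simp [h]
      change b _ ↔ b _
      rw [e]
      exact hM _ i ⟨j, by rwa [Function.update_of_ne hij.symm]⟩
  have hconst : ∀ (k : Fin N → ℤ) (j : Fin N), M < |k j| → (b k ↔ b fun _ => M + 1) := by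
    intro k j hj
    have hM1 : M < |M + 1| := by rw [abs_of_nonneg] <;> omega
    have hfin : ∀ s : Finset (Fin N), j ∉ s → (b k ↔ b fun i => if i ∈ s then M + 1 else k i) := by
      intro s
      induction s using Finset.induction_on with
      | empty => simp
      | insert i s hi ih =>
        intro hjs
        rw [Finset.mem_insert, not_or] at hjs
        rw [ih hjs.2, hupd _ i j (Ne.symm hjs.1) (by simpa [hjs.2] using hj) (M + 1)]
        refine iff_of_eq (congrArg b ?_)
        ext l
        by_cases h : l = i
        · subst h; simp
        · simp [h]
    have : Nontrivial (Fin N) := Fin.nontrivial_iff_two_le.2 hN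
    obtain ⟨i, hi⟩ := exists_ne j
    rw [hfin (Finset.univ.erase j) (by simp), hupd _ j i hi.symm (by simpa [hi] using hM1) (M + 1)]
    refine iff_of_eq (congrArg b ?_)
    ext l
    by_cases h : l = j
    · subst h; simp
    · simp [h]
  by_cases hc : b fun _ => M + 1
  · right
    refine (finite_box M).subset fun k hk j => ?_
    by_contra h
    exact hk ((hconst k j (not_le.1 h)).2 hc)
  · left
    refine (finite_box M).subset fun k hk j => ?_
    by_contra h
    exact hc ((hconst k j (not_le.1 h)).1 hk)

/-- On the integers, a subset with finite edge boundary that is neither finite nor cofinite agrees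
with a half line outside a bounded interval. -/
theorem exists_bound_half_line {b : (Fin 1 → ℤ) → Prop}
    (hb : ∀ i, {k | ¬ (b k ↔ b (k + Pi.single i 1))}.Finite)
    (h1 : ¬ {k | b k}.Finite) (h2 : ¬ {k | ¬ b k}.Finite) :
    ∃ M : ℤ, (∀ k, M < |k 0| → (b k ↔ 0 ≤ k 0)) ∨ (∀ k, M < |k 0| → (b k ↔ k 0 < 0)) := by
  obtain ⟨M, hM0, hM⟩ := exists_bound_edge hb
  have hstep : ∀ z : ℤ, M < |z| → ((b fun _ => z) ↔ (b fun _ => z + 1)) := by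
    intro z hz
    rw [hM (fun _ => z) 0 ⟨0, hz⟩]
    refine iff_of_eq (congrArg b ?_)
    ext l
    fin_cases l; simp
  have hpos : ∀ z : ℤ, M < z → ((b fun _ => z) ↔ (b fun _ => M + 1)) := by
    intro z hz
    induction z, (show M + 1 ≤ z by omega) using Int.leInduction with
    | base => rfl
    | succ z hz' ih =>
      rw [← hstep z (lt_of_lt_of_le (by omega) (le_abs_self z)), ih (by omega)]
  have hneg : ∀ z : ℤ, z < -M → ((b fun _ => z) ↔ (b fun _ => -M - 1)) := by
    intro z hz
    induction z, (show z ≤ -M - 1 by omega) using Int.leInductionDown with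
    | base => rfl
    | pred z hz' ih =>
      rw [hstep (z - 1) (lt_of_lt_of_le (by omega) (neg_le_abs _)), sub_add_cancel, ih (by omega)]
  have hk : ∀ k : Fin 1 → ℤ, k = fun _ => k 0 := fun k => by ext l; fin_cases l; rfl
  have hside : ∀ k : Fin 1 → ℤ, M < |k 0| →
      (0 ≤ k 0 ∧ (b k ↔ b fun _ => M + 1)) ∨ (k 0 < 0 ∧ (b k ↔ b fun _ => -M - 1)) := by
    intro k hkM
    rcases lt_abs.1 hkM with h | h
    · left; refine ⟨by omega, ?_⟩; rw [← hpos (k 0) h, ← hk k]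
    · right; refine ⟨by omega, ?_⟩; rw [← hneg (k 0) (by omega), ← hk k]
  have hbox : ∀ {s : Set (Fin 1 → ℤ)}, (∀ k, M < |k 0| → k ∉ s) → s.Finite := by
    intro s hs
    refine (finite_box M).subset fun k hks j => ?_
    by_contra h
    fin_cases j
    exact hs k (not_le.1 h) hks
  refine ⟨M, ?_⟩
  by_cases hp : b fun _ => M + 1 <;> by_cases hn : b fun _ => -M - 1
  · refine absurd (hbox fun k hkM => ?_) h2
    rcases hside k hkM with h | h
    · exact not_not.2 (h.2.2 hp)
    · exact not_not.2 (h.2.2 hn)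
  · left
    intro k hkM
    rcases hside k hkM with h | h
    · exact ⟨fun _ => h.1, fun _ => h.2.2 hp⟩
    · exact ⟨fun h' => absurd (h.2.1 h') hn, fun h' => absurd h' (not_le.2 h.1)⟩
  · right
    intro k hkM
    rcases hside k hkM with h | h
    · exact ⟨fun h' => absurd (h.2.1 h') hp, fun h' => absurd h.1 (not_le.2 h')⟩
    · exact ⟨fun _ => h.1, fun _ => h.2.2 hn⟩
  · refine absurd (hbox fun k hkM => ?_) h1
    rcases hside k hkM with h | h
    · exact fun h' => hp (h.2.1 h')
    · exact fun h' => hn (h.2.1 h')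

/-- The lattice index of the cube of side `s` that contains `x`. -/
noncomputable def gridIndex (s : ℝ) (x : EuclideanSpace ℝ (Fin N)) : Fin N → ℤ := fun i => ⌊x i / s⌋

/-- The half-open cube of side `s` with index `k`. -/
def cell (s : ℝ) (k : Fin N → ℤ) : Set (EuclideanSpace ℝ (Fin N)) := {x | gridIndex s x = k}

theorem measurable_gridIndex (s : ℝ) :
    Measurable (gridIndex s : EuclideanSpace ℝ (Fin N) → Fin N → ℤ) :=
  measurable_pi_lambda _ fun i =>
    Int.measurable_floor.comp (by fun_prop : Measurable fun x : EuclideanSpace ℝ (Fin N) => x i / s)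

theorem measurableSet_cell (s : ℝ) (k : Fin N → ℤ) : MeasurableSet (cell s k) :=
  measurable_gridIndex s (measurableSet_singleton k)

theorem volume_box (a b : Fin N → ℝ) :
    volume {x : EuclideanSpace ℝ (Fin N) | ∀ i, a i ≤ x i ∧ x i < b i} =
      ∏ i, ENNReal.ofReal (b i - a i) := by
  rw [← Real.volume_pi_Ico, ← (PiLp.volume_preserving_ofLp (Fin N)).measure_preimage
    (MeasurableSet.univ_pi fun i => measurableSet_Ico).nullMeasurableSet]
  congr 1
  ext x
  simp [Set.mem_pi]

theorem mem_cell_iff {s : ℝ} (hs : 0 < s) {k : Fin N → ℤ} {x : EuclideanSpace ℝ (Fin N)} :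
    x ∈ cell s k ↔ ∀ i, s * k i ≤ x i ∧ x i < s * (k i + 1) := by
  change gridIndex s x = k ↔ _
  rw [funext_iff]
  refine forall_congr' fun i => ?_
  rw [gridIndex, Int.floor_eq_iff, le_div_iff₀ hs, div_lt_iff₀ hs, mul_comm s, mul_comm s]

theorem volume_cell {s : ℝ} (hs : 0 < s) (k : Fin N → ℤ) :
    volume (cell s k) = ENNReal.ofReal s ^ N := by
  have : cell s k = {x | ∀ i, s * k i ≤ x i ∧ x i < s * (k i + 1)} :=
    Set.ext fun x => mem_cell_iff hs
  rw [this, volume_box (fun i => s * k i) (fun i => s * (k i + 1))]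
  have : ∀ i, s * ((k i : ℝ) + 1) - s * k i = s := fun i => by ring
  simp [this]

theorem norm_sub_lt_of_mem_cell {s r : ℝ} (hs : 0 < s) (hsr : 2 * s * N < r) {k k' : Fin N → ℤ}
    (hkk : ∀ i, |k i - k' i| ≤ 1) {x y : EuclideanSpace ℝ (Fin N)} (hx : x ∈ cell s k)
    (hy : y ∈ cell s k') : ‖x - y‖ < r := by
  rw [mem_cell_iff hs] at hx hy
  have hi : ∀ i, |(x - y) i| ≤ 2 * s := by
    intro i
    have h1 : |(k i : ℝ) - k' i| ≤ 1 := by exact_mod_cast hkk i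
    rw [abs_le] at h1 ⊢
    have h2 := hx i
    have h3 := hy i
    rw [PiLp.sub_apply]
    constructor <;> nlinarith
  refine lt_of_le_of_lt ?_ hsr
  rw [EuclideanSpace.norm_eq]
  refine Real.sqrt_le_iff.2 ⟨by positivity, ?_⟩
  calc ∑ i, ‖(x - y) i‖ ^ 2 ≤ ∑ _i : Fin N, (2 * s) ^ 2 :=
        Finset.sum_le_sum fun i _ => pow_le_pow_left₀ (norm_nonneg _) (hi i) 2
    _ = N * (2 * s) ^ 2 := by simp
    _ ≤ (2 * s * N) ^ 2 := by
      have : (N : ℝ) ≤ N ^ 2 := by exact_mod_cast Nat.le_self_pow two_ne_zero N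
      nlinarith [sq_nonneg (2 * s)]

/-- The interactions between neighbouring cells are controlled by the perimeter. -/
theorem tsum_cell_le_per {H : EuclideanSpace ℝ (Fin N) → ℝ≥0∞} {μ : ℝ≥0∞} {s r : ℝ}
    (hH : ∀ x, ‖x‖ < r → μ ≤ H x) (hs : 0 < s) (hsr : 2 * s * N < r)
    {E : Set (EuclideanSpace ℝ (Fin N))} (hE : MeasurableSet E) {e : Fin N → ℤ}
    (he : ∀ i, |e i| ≤ 1) :
    ∑' k, volume (E ∩ cell s k) * (μ * volume (cell s (k + e) \ E)) ≤ per H E := by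
  have hunion : (⋃ k, E ∩ cell s k) = E := by
    rw [← Set.inter_iUnion]
    refine Set.inter_eq_left.2 fun x _ => Set.mem_iUnion.2 ⟨gridIndex s x, rfl⟩
  have hdisj : Pairwise (Function.onFun Disjoint fun k => E ∩ cell s k) := by
    intro k k' hkk
    refine Set.disjoint_left.2 fun x hx hx' => hkk ?_
    exact (show gridIndex s x = k from hx.2).symm.trans hx'.2
  rw [show per H E = ∫⁻ x in ⋃ k, E ∩ cell s k, ∫⁻ y in Eᶜ, H (x - y) by rw [hunion, per],
    lintegral_iUnion (fun k => hE.inter (measurableSet_cell s k)) hdisj]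
  refine ENNReal.tsum_le_tsum fun k => ?_
  calc volume (E ∩ cell s k) * (μ * volume (cell s (k + e) \ E))
      = ∫⁻ _ in E ∩ cell s k, μ * volume (cell s (k + e) \ E) := by
        rw [setLIntegral_const, mul_comm]
    _ ≤ _ := by
      refine setLIntegral_mono' (hE.inter (measurableSet_cell s k)) fun x hx => ?_
      calc μ * volume (cell s (k + e) \ E) = ∫⁻ _ in cell s (k + e) \ E, μ := by
            rw [setLIntegral_const]
        _ ≤ ∫⁻ y in cell s (k + e) \ E, H (x - y) := by
            refine setLIntegral_mono' ((measurableSet_cell _ _).diff hE) fun y hy => hH _ ?_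
            exact norm_sub_lt_of_mem_cell hs hsr (fun i => by simpa using he i) hx.2 hy.1
        _ ≤ _ := lintegral_mono_set fun y hy => hy.2

/-- If the kernel is bounded below near the origin, a set of finite perimeter differs by finite
measure from a union of cells whose index set has finite edge boundary. -/
theorem exists_grid_approximation {H : EuclideanSpace ℝ (Fin N) → ℝ≥0∞} {μ : ℝ≥0∞} {r : ℝ}
    (hμ : μ ≠ 0) (hr : 0 < r) (hH : ∀ x, ‖x‖ < r → μ ≤ H x)
    {E : Set (EuclideanSpace ℝ (Fin N))} (hE : MeasurableSet E) (hper : per H E ≠ ⊤) :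
    ∃ (s : ℝ) (b : (Fin N → ℤ) → Prop), 0 < s ∧
      (∀ i, {k | ¬ (b k ↔ b (k + Pi.single i 1))}.Finite) ∧
      volume (E \ {x | b (gridIndex s x)}) ≠ ⊤ ∧ volume ({x | b (gridIndex s x)} \ E) ≠ ⊤ := by
  set s : ℝ := r / (2 * (N + 1)) with hs
  have hs0 : 0 < s := by positivity
  have hsr : 2 * s * N < r := by
    have : 2 * s * (N + 1) = r := by rw [hs]; field_simp
    nlinarith
  set v : ℝ≥0∞ := ENNReal.ofReal s ^ N with hv
  have hv0 : v ≠ 0 := pow_ne_zero _ (by simpa using hs0)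
  have hvf : v ≠ ⊤ := ENNReal.pow_ne_top ENNReal.ofReal_ne_top
  set a : (Fin N → ℤ) → ℝ≥0∞ := fun k => volume (E ∩ cell s k) with ha
  set c : (Fin N → ℤ) → ℝ≥0∞ := fun k => volume (cell s k \ E) with hc
  have hac : ∀ k, a k + c k = v := fun k => by
    rw [ha, hc]
    simp only
    rw [Set.inter_comm, measure_inter_add_sdiff _ hE, volume_cell hs0]
  set b : (Fin N → ℤ) → Prop := fun k => c k < a k with hb
  have hsum : ∀ e : Fin N → ℤ, (∀ i, |e i| ≤ 1) → ∑' k, a k * (μ * c (k + e)) ≠ ⊤ := fun e he =>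
    ne_top_of_le_ne_top hper (tsum_cell_le_per hH hs0 hsr hE he)
  have hva : ∀ k, b k → v ≤ 2 * a k := fun k hk => by
    rw [← hac k, two_mul]; gcongr
  have hvc : ∀ k, ¬ b k → v ≤ 2 * c k := fun k hk => by
    rw [← hac k, two_mul]; gcongr; exact not_lt.1 hk
  have hlow : v / 2 * (μ * (v / 2)) ≠ 0 := by
    have : v / 2 ≠ 0 := by simpa using hv0
    exact mul_ne_zero this (mul_ne_zero hμ this)
  have hbad : ∀ e : Fin N → ℤ, (∀ i, |e i| ≤ 1) → {k | b k ∧ ¬ b (k + e)}.Finite := by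
    intro e he
    refine (ENNReal.finite_const_le_of_tsum_ne_top (hsum e he) hlow).subset ?_
    rintro k ⟨h1, h2⟩
    change _ ≤ a k * (μ * c (k + e))
    gcongr
    · exact ENNReal.div_le_of_le_mul' (hva k h1)
    · exact ENNReal.div_le_of_le_mul' (hvc _ h2)
  have hunion : ∀ F : Set (EuclideanSpace ℝ (Fin N)), volume F ≤ ∑' k, volume (F ∩ cell s k) := by
    intro F
    refine le_trans (measure_mono ?_) (measure_iUnion_le _)
    exact fun x hx => Set.mem_iUnion.2 ⟨gridIndex s x, hx, rfl⟩
  have hsum0 : ∑' k, 2 * (a k * (μ * c k)) ≠ ⊤ := by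
    rw [ENNReal.tsum_mul_left]
    simpa using ENNReal.mul_ne_top (by simp : (2 : ℝ≥0∞) ≠ ⊤) (hsum 0 (by simp))
  have hfin : ∀ F : Set (EuclideanSpace ℝ (Fin N)),
      (∀ k, v * μ * volume (F ∩ cell s k) ≤ 2 * (a k * (μ * c k))) → volume F ≠ ⊤ := by
    intro F hF hFt
    have h1 : v * μ * ∑' k, volume (F ∩ cell s k) ≤ ∑' k, 2 * (a k * (μ * c k)) := by
      rw [← ENNReal.tsum_mul_left]
      exact ENNReal.tsum_le_tsum hF
    have h2 : ∑' k, volume (F ∩ cell s k) = ⊤ := top_le_iff.1 (hFt ▸ hunion F)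
    rw [h2, ENNReal.mul_top (mul_ne_zero hv0 hμ)] at h1
    exact hsum0 (top_le_iff.1 h1)
  refine ⟨s, b, hs0, fun i => ?_, hfin _ fun k => ?_, hfin _ fun k => ?_⟩
  · have h1 := hbad (Pi.single i 1) fun j => by
      by_cases h : j = i
      · subst h; simp
      · simp [h]
    have h2 := hbad (-Pi.single i 1) fun j => by
      by_cases h : j = i
      · subst h; simp
      · simp [h]
    refine (h1.union (h2.preimage ((add_left_injective (Pi.single i 1)).injOn))).subset ?_
    intro k hk
    change ¬ (b k ↔ b (k + Pi.single i 1)) at hk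
    by_cases h : b k
    · exact Or.inl ⟨h, fun h' => hk ⟨fun _ => h', fun _ => h⟩⟩
    · right
      refine ⟨by_contra fun h' => hk ⟨fun h'' => absurd h'' h, fun h'' => absurd h'' h'⟩, ?_⟩
      simpa using h
  · by_cases h : b k
    · have : E \ {x | b (gridIndex s x)} ∩ cell s k = ∅ := by
        ext x
        simp only [Set.mem_inter_iff, Set.mem_empty_iff_false, iff_false]
        rintro ⟨⟨-, hx⟩, rfl⟩
        exact hx h
      simp [this]
    · calc v * μ * volume (E \ {x | b (gridIndex s x)} ∩ cell s k) ≤ (2 * c k) * μ * a k := by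
            gcongr
            · exact hvc k h
            · exact measure_mono fun x hx => ⟨hx.1.1, hx.2⟩
        _ = _ := by ring
  · by_cases h : b k
    · calc v * μ * volume ({x | b (gridIndex s x)} \ E ∩ cell s k) ≤ (2 * a k) * μ * c k := by
            gcongr
            · exact hva k h
            · exact measure_mono fun x hx => ⟨hx.2, hx.1.2⟩
        _ = _ := by ring
    · have : {x | b (gridIndex s x)} \ E ∩ cell s k = ∅ := by
        ext x
        simp only [Set.mem_inter_iff, Set.mem_empty_iff_false, iff_false]
        rintro ⟨⟨hx, -⟩, rfl⟩
        exact h hx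
      simp [this]

theorem volume_gridIndex_preimage_ne_top {s : ℝ} (hs : 0 < s) {p : Set (Fin N → ℤ)}
    (hp : p.Finite) : volume {x : EuclideanSpace ℝ (Fin N) | gridIndex s x ∈ p} ≠ ⊤ := by
  have : {x : EuclideanSpace ℝ (Fin N) | gridIndex s x ∈ p} = ⋃ k ∈ p, cell s k := by
    ext x; simp [cell]
  rw [this]
  refine (measure_biUnion_lt_top hp fun k _ => ?_).ne
  rw [volume_cell hs]
  exact ENNReal.pow_lt_top ENNReal.ofReal_lt_top

/-! ### Sets of infinite measure with infinite complement -/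

theorem per_congr_ae {H H' : EuclideanSpace ℝ (Fin N) → ℝ≥0∞} (h : H =ᵐ[volume] H')
    (E : Set (EuclideanSpace ℝ (Fin N))) : per H E = per H' E :=
  le_antisymm (per_mono_ae h.le E) (per_mono_ae h.symm.le E)

theorem per_compl {H : EuclideanSpace ℝ (Fin N) → ℝ≥0∞} (hH : Measurable H)
    (heven : ∀ᵐ z, H (-z) = H z) (E : Set (EuclideanSpace ℝ (Fin N))) : per H Eᶜ = per H E := by
  calc per H Eᶜ = ∫⁻ x in Eᶜ, ∫⁻ y in E, H (x - y) := by rw [per, compl_compl]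
    _ = ∫⁻ y in E, ∫⁻ x in Eᶜ, H (x - y) := lintegral_lintegral_swap
        (hH.comp (show Measurable fun p : EuclideanSpace ℝ (Fin N) × EuclideanSpace ℝ (Fin N) =>
          p.1 - p.2 by fun_prop)).aemeasurable
    _ = per (fun z => H (-z)) E := by simp only [per, neg_sub]
    _ = per H E := per_congr_ae heven E

/-- A kernel may be replaced by a measurable one without changing any perimeter. -/
theorem IsKernel.exists_measurable (hN : N ≠ 0) {K : EuclideanSpace ℝ (Fin N) → ℝ≥0}
    (hK : IsKernel K) : ∃ H : EuclideanSpace ℝ (Fin N) → ℝ≥0∞, Measurable H ∧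
      (H =ᵐ[volume] fun x => (K x : ℝ≥0∞)) ∧ (∀ E, per H E = per (fun x => (K x : ℝ≥0∞)) E) ∧
      ∀ E, per H Eᶜ = per H E := by
  have hKm := (hK.aemeasurable hN).coe_nnreal_ennreal
  have hae : hKm.mk _ =ᵐ[volume] fun x => (K x : ℝ≥0∞) := hKm.ae_eq_mk.symm
  refine ⟨hKm.mk _, hKm.measurable_mk, hae, per_congr_ae hae, per_compl hKm.measurable_mk ?_⟩
  have hneg := (Measure.measurePreserving_neg
    (volume : Measure (EuclideanSpace ℝ (Fin N)))).quasiMeasurePreserving.ae hae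
  filter_upwards [hae, hneg] with z h1 h2
  rw [h1, h2, hK.symm z]

theorem per_eq_lintegral_shift {H : EuclideanSpace ℝ (Fin N) → ℝ≥0∞} (hH : Measurable H)
    {E : Set (EuclideanSpace ℝ (Fin N))} (hE : MeasurableSet E) :
    per H E = ∫⁻ z, H z * volume {x | x ∈ E ∧ x - z ∉ E} := by
  set S : Set (EuclideanSpace ℝ (Fin N) × EuclideanSpace ℝ (Fin N)) :=
    {p | p.1 ∈ E ∧ p.1 - p.2 ∉ E} with hSdef
  have hS : MeasurableSet S :=
    (measurable_fst hE).inter ((measurable_fst.sub measurable_snd) hE.compl)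
  have hm : Measurable fun p : EuclideanSpace ℝ (Fin N) × EuclideanSpace ℝ (Fin N) =>
      S.indicator (fun p => H p.2) p :=
    (hH.comp measurable_snd).indicator hS
  calc per H E = ∫⁻ x in E, ∫⁻ z, Eᶜ.indicator (fun y => H (x - y)) (x - z) := by
        refine lintegral_congr fun x => ?_
        rw [lintegral_sub_left_eq_self (fun y => Eᶜ.indicator (fun y => H (x - y)) y) x,
          lintegral_indicator hE.compl]
    _ = ∫⁻ x, ∫⁻ z, S.indicator (fun p => H p.2) (x, z) := by
        rw [← lintegral_indicator hE]
        refine lintegral_congr fun x => ?_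
        by_cases hx : x ∈ E
        · rw [Set.indicator_of_mem hx]
          refine lintegral_congr fun z => ?_
          by_cases hz : x - z ∈ E
          · rw [Set.indicator_of_notMem (by simpa using hz),
              Set.indicator_of_notMem (fun h => h.2 hz)]
          · rw [Set.indicator_of_mem (by simpa using hz),
              Set.indicator_of_mem (show (x, z) ∈ S from ⟨hx, hz⟩)]
            simp
        · rw [Set.indicator_of_notMem hx]
          have : ∀ z, S.indicator (fun p => H p.2) (x, z) = 0 := fun z =>
            Set.indicator_of_notMem (fun h => hx h.1) _
          simp [this]
    _ = ∫⁻ z, ∫⁻ x, S.indicator (fun p => H p.2) (x, z) :=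
        lintegral_lintegral_swap hm.aemeasurable
    _ = _ := by
        refine lintegral_congr fun z => ?_
        have hz : MeasurableSet {x | x ∈ E ∧ x - z ∉ E} := measurable_prodMk_right hS
        rw [← lintegral_indicator_const hz]
        rfl

theorem norm_eq_abs_apply_zero (z : EuclideanSpace ℝ (Fin 1)) : ‖z‖ = |z 0| := by
  rw [EuclideanSpace.norm_eq]
  simp [Real.sqrt_sq_eq_abs]

theorem measurableSet_Ico_one (a b : ℝ) :
    MeasurableSet {x : EuclideanSpace ℝ (Fin 1) | a ≤ x 0 ∧ x 0 < b} :=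
  (by fun_prop : Measurable fun x : EuclideanSpace ℝ (Fin 1) => x 0) measurableSet_Ico

theorem volume_Ico_one (a b : ℝ) :
    volume {x : EuclideanSpace ℝ (Fin 1) | a ≤ x 0 ∧ x 0 < b} = ENNReal.ofReal (b - a) := by
  have := volume_box (N := 1) (fun _ => a) (fun _ => b)
  simpa using this

theorem ofReal_add_ofReal_neg (a : ℝ) :
    ENNReal.ofReal a + ENNReal.ofReal (-a) = ENNReal.ofReal |a| := by
  rcases le_total 0 a with h | h
  · rw [ENNReal.ofReal_of_nonpos (neg_nonpos.2 h), add_zero, abs_of_nonneg h]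
  · rw [ENNReal.ofReal_of_nonpos h, zero_add, abs_of_nonpos h]

/-- If a set close to a half line has finite perimeter, then the perimeters of all intervals are
bounded: long translations move a half line as much as they move any interval. -/
theorem exists_bound_per_interval {H : EuclideanSpace ℝ (Fin 1) → ℝ≥0∞} (hH : Measurable H)
    (hint : ∫⁻ z, H z * ENNReal.ofReal (min ‖z‖ 1) ≠ ⊤) {E : Set (EuclideanSpace ℝ (Fin 1))}
    (hE : MeasurableSet E) (hper : per H E ≠ ⊤) (hperc : per H Eᶜ ≠ ⊤)
    (h1 : volume (E \ {x | 0 ≤ x 0}) ≠ ⊤) (h2 : volume ({x | 0 ≤ x 0} \ E) ≠ ⊤) :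
    ∃ B : ℝ≥0∞, B ≠ ⊤ ∧ ∀ m : ℝ, per H {x | 0 ≤ x 0 ∧ x 0 < m} ≤ B := by
  set P : Set (EuclideanSpace ℝ (Fin 1)) := {x | 0 ≤ x 0} with hP
  have hPm : MeasurableSet P := measurableSet_le measurable_const (by fun_prop)
  set D := volume (E \ P) + volume (P \ E) with hD
  have hDf : D ≠ ⊤ := ENNReal.add_ne_top.2 ⟨h1, h2⟩
  set φ : EuclideanSpace ℝ (Fin 1) → ℝ≥0∞ := fun z =>
    volume {x | x ∈ E ∧ x - z ∉ E} + volume {x | x ∈ Eᶜ ∧ x - z ∉ Eᶜ} with hφ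
  have hshift : ∀ (F : Set (EuclideanSpace ℝ (Fin 1))) z, MeasurableSet F →
      volume {x | x - z ∈ F} = volume F := fun F z hF =>
    (measurePreserving_sub_right volume z).measure_preimage hF.nullMeasurableSet
  have hhalf : ∀ z, ENNReal.ofReal ‖z‖ ≤ φ z + 2 * D := by
    intro z
    have hsub1 : {x | x ∈ P ∧ x - z ∉ P} ⊆
        {x | x ∈ E ∧ x - z ∉ E} ∪ (P \ E) ∪ {x | x - z ∈ E \ P} := by
      rintro x ⟨hx, hxz⟩
      by_cases hxE : x ∈ E
      · by_cases hxzE : x - z ∈ E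
        · exact Or.inr ⟨hxzE, hxz⟩
        · exact Or.inl (Or.inl ⟨hxE, hxzE⟩)
      · exact Or.inl (Or.inr ⟨hx, hxE⟩)
    have hsub2 : {x | x ∉ P ∧ x - z ∈ P} ⊆
        {x | x ∈ Eᶜ ∧ x - z ∉ Eᶜ} ∪ (E \ P) ∪ {x | x - z ∈ P \ E} := by
      rintro x ⟨hx, hxz⟩
      by_cases hxE : x ∈ E
      · exact Or.inl (Or.inr ⟨hxE, hx⟩)
      · by_cases hxzE : x - z ∈ E
        · exact Or.inl (Or.inl ⟨hxE, fun h => h hxzE⟩)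
        · exact Or.inr ⟨hxz, hxzE⟩
    have e1 : ENNReal.ofReal (z 0) ≤ volume {x | x ∈ P ∧ x - z ∉ P} := by
      rw [← sub_zero (z 0), ← volume_Ico_one]
      refine measure_mono fun x hx => ⟨hx.1, ?_⟩
      change ¬ 0 ≤ (x - z) 0
      rw [PiLp.sub_apply, not_le]
      linarith [hx.2]
    have e2 : ENNReal.ofReal (-z 0) ≤ volume {x | x ∉ P ∧ x - z ∈ P} := by
      rw [← zero_sub, ← volume_Ico_one]
      refine measure_mono fun x hx => ⟨not_le.2 hx.2, ?_⟩
      change 0 ≤ (x - z) 0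
      rw [PiLp.sub_apply]
      linarith [hx.1]
    rw [norm_eq_abs_apply_zero, ← ofReal_add_ofReal_neg]
    have b1 := e1.trans ((measure_mono hsub1).trans
      ((measure_union_le _ _).trans (add_le_add (measure_union_le _ _) le_rfl)))
    have b2 := e2.trans ((measure_mono hsub2).trans
      ((measure_union_le _ _).trans (add_le_add (measure_union_le _ _) le_rfl)))
    rw [hshift _ z (hE.diff hPm)] at b1
    rw [hshift _ z (hPm.diff hE)] at b2
    refine (add_le_add b1 b2).trans (le_of_eq ?_)
    simp only [hφ, hD]
    ring
  have hinterval : ∀ (m : ℝ) (z : EuclideanSpace ℝ (Fin 1)),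
      volume {x : EuclideanSpace ℝ (Fin 1) |
        x ∈ {x : EuclideanSpace ℝ (Fin 1) | 0 ≤ x 0 ∧ x 0 < m} ∧
        x - z ∉ {x : EuclideanSpace ℝ (Fin 1) | 0 ≤ x 0 ∧ x 0 < m}} ≤ ENNReal.ofReal ‖z‖ := by
    intro m z
    rw [norm_eq_abs_apply_zero, ← ofReal_add_ofReal_neg,
      show z 0 = z 0 - 0 by ring, show -(z 0 - 0) = m - (m + z 0) by ring, ← volume_Ico_one,
      ← volume_Ico_one]
    refine le_trans (measure_mono ?_) (measure_union_le _ _)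
    rintro x ⟨⟨hx0, hxm⟩, hxz⟩
    by_cases h : x 0 < z 0
    · exact Or.inl ⟨hx0, h⟩
    · right
      refine ⟨?_, hxm⟩
      by_contra h'
      refine hxz ?_
      change 0 ≤ (x - z) 0 ∧ (x - z) 0 < m
      rw [PiLp.sub_apply]
      constructor <;> linarith
  have hIm : ∀ m : ℝ, MeasurableSet {x : EuclideanSpace ℝ (Fin 1) | 0 ≤ x 0 ∧ x 0 < m} := fun m =>
    measurableSet_Ico_one 0 m
  have hSm : ∀ F : Set (EuclideanSpace ℝ (Fin 1)), MeasurableSet F → Measurable fun z =>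
      H z * volume {x | x ∈ F ∧ x - z ∉ F} := by
    intro F hF
    have hS : MeasurableSet {p : EuclideanSpace ℝ (Fin 1) × EuclideanSpace ℝ (Fin 1) |
        p.2 ∈ F ∧ p.2 - p.1 ∉ F} :=
      (measurable_snd hF).inter ((measurable_snd.sub measurable_fst) hF.compl)
    exact hH.mul (measurable_measure_prodMk_left hS)
  refine ⟨(1 + 2 * D) * (∫⁻ z, H z * ENNReal.ofReal (min ‖z‖ 1)) + (per H E + per H Eᶜ), ?_, ?_⟩
  · exact ENNReal.add_ne_top.2 ⟨ENNReal.mul_ne_top (ENNReal.add_ne_top.2 ⟨ENNReal.one_ne_top,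
      ENNReal.mul_ne_top (by simp) hDf⟩) hint, ENNReal.add_ne_top.2 ⟨hper, hperc⟩⟩
  · intro m
    rw [per_eq_lintegral_shift hH (hIm m), per_eq_lintegral_shift hH hE,
      per_eq_lintegral_shift hH hE.compl, ← lintegral_add_left (hSm E hE),
      ← lintegral_const_mul _ (by fun_prop), ← lintegral_add_left (by fun_prop)]
    refine lintegral_mono fun z => ?_
    have hkey : volume {x : EuclideanSpace ℝ (Fin 1) |
        x ∈ {x : EuclideanSpace ℝ (Fin 1) | 0 ≤ x 0 ∧ x 0 < m} ∧
        x - z ∉ {x : EuclideanSpace ℝ (Fin 1) | 0 ≤ x 0 ∧ x 0 < m}} ≤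
        (1 + 2 * D) * ENNReal.ofReal (min ‖z‖ 1) + φ z := by
      refine (hinterval m z).trans ?_
      rcases le_total ‖z‖ 1 with h | h
      · rw [min_eq_left h, add_mul, one_mul, add_assoc]
        exact le_self_add
      · rw [min_eq_right h, ENNReal.ofReal_one, mul_one]
        refine (hhalf z).trans ?_
        rw [add_comm (φ z)]
        gcongr
        exact le_add_self
    calc _ ≤ H z * ((1 + 2 * D) * ENNReal.ofReal (min ‖z‖ 1) + φ z) := by gcongr
      _ = _ := by simp only [hφ]; ring

/-- Under a power lower bound for the isoperimetric profile and a positive lower bound for the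
kernel near the origin, a set of finite perimeter has finite measure or finite complement. -/
theorem per_eq_top (hN : N ≠ 0) {K : EuclideanSpace ℝ (Fin N) → ℝ≥0} (hK : IsKernel K)
    {μ r : ℝ} (hμ : 0 < μ) (hr : 0 < r)
    (hK0 : ∀ x ∈ Metric.ball (0 : EuclideanSpace ℝ (Fin N)) r, μ ≤ (K x : ℝ))
    {k C : ℝ} (hk : 1 ≤ k) (hC : 0 < C)
    (hg : ∀ m : ℝ≥0, 0 < m → ENNReal.ofReal ((m : ℝ) ^ (1 / k) / C) ≤ profile K m)
    {E : Set (EuclideanSpace ℝ (Fin N))} (hE : MeasurableSet E) (h1 : volume E = ⊤)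
    (h2 : volume Eᶜ = ⊤) : per (fun x => (K x : ℝ≥0∞)) E = ⊤ := by
  by_contra hper
  obtain ⟨s, b, hs, hb, hd1, hd2⟩ := exists_grid_approximation (H := fun x => (K x : ℝ≥0∞))
    (μ := ENNReal.ofReal μ) (by simpa using hμ) hr (fun x hx => by
      rw [← ENNReal.ofReal_coe_nnreal]
      exact ENNReal.ofReal_le_ofReal (hK0 x (mem_ball_zero_iff.2 hx))) hE hper
  set G : Set (EuclideanSpace ℝ (Fin N)) := {x | b (gridIndex s x)} with hG
  have hnb : ¬ {k | b k}.Finite := by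
    intro hf
    have hGf : volume G ≠ ⊤ := volume_gridIndex_preimage_ne_top hs hf
    refine ENNReal.add_ne_top.2 ⟨hd1, hGf⟩ (top_le_iff.1 ?_)
    rw [← h1]
    refine le_trans (measure_mono fun x hx => ?_) (measure_union_le _ _)
    by_cases h : x ∈ G
    · exact Or.inr h
    · exact Or.inl ⟨hx, h⟩
  have hnb' : ¬ {k | ¬ b k}.Finite := by
    intro hf
    have hGf : volume Gᶜ ≠ ⊤ := volume_gridIndex_preimage_ne_top hs hf
    refine ENNReal.add_ne_top.2 ⟨hd2, hGf⟩ (top_le_iff.1 ?_)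
    rw [← h2]
    refine le_trans (measure_mono fun x hx => ?_) (measure_union_le _ _)
    by_cases h : x ∈ G
    · exact Or.inl ⟨h, hx⟩
    · exact Or.inr h
  rcases Nat.lt_or_ge N 2 with hN2 | hN2
  swap
  · exact (finite_or_cofinite_of_two_le hN2 hb).elim hnb hnb'
  obtain rfl : N = 1 := by omega
  obtain ⟨H, hHm, hHK, hHper, hHc⟩ := hK.exists_measurable hN
  rw [← hHper] at hper
  have hint : ∫⁻ z, H z * ENNReal.ofReal (min ‖z‖ 1) ≠ ⊤ := by
    have h := hK.integrable.lintegral_lt_top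
    refine ne_of_lt (lt_of_le_of_lt (le_of_eq (lintegral_congr_ae ?_)) h)
    filter_upwards [hHK] with z hz
    rw [hz, mul_comm (min ‖z‖ 1), ENNReal.ofReal_mul (NNReal.coe_nonneg _),
      ENNReal.ofReal_coe_nnreal]
  have hPs : ∀ x : EuclideanSpace ℝ (Fin 1), 0 ≤ x 0 ↔ 0 ≤ gridIndex s x 0 := fun x => by
    rw [gridIndex, Int.floor_nonneg, div_nonneg_iff]
    constructor
    · exact fun h => Or.inl ⟨h, hs.le⟩
    · rintro (h | h)
      · exact h.1
      · exact absurd h.2 (not_le.2 hs)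
  obtain ⟨M, hM⟩ := exists_bound_half_line hb hnb hnb'
  have hbox : volume {x : EuclideanSpace ℝ (Fin 1) | gridIndex s x ∈ {k | ∀ j, |k j| ≤ M}} ≠ ⊤ :=
    volume_gridIndex_preimage_ne_top hs (finite_box M)
  have hcover : ∀ F F' : Set (EuclideanSpace ℝ (Fin 1)), volume F' ≠ ⊤ →
      (∀ x ∈ F, M < |gridIndex s x 0| → x ∈ F') → volume F ≠ ⊤ := by
    intro F F' hF' h
    refine ne_top_of_le_ne_top (ENNReal.add_ne_top.2 ⟨hF', hbox⟩)
      (le_trans (measure_mono fun x hx => ?_) (measure_union_le _ _))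
    by_cases hxM : M < |gridIndex s x 0|
    · exact Or.inl (h x hx hxM)
    · refine Or.inr fun j => ?_
      fin_cases j
      exact not_lt.1 hxM
  obtain ⟨B, hB, hBper⟩ : ∃ B : ℝ≥0∞, B ≠ ⊤ ∧ ∀ m : ℝ, per H {x | 0 ≤ x 0 ∧ x 0 < m} ≤ B := by
    rcases hM with hM | hM
    · refine exists_bound_per_interval hHm hint hE hper (hHc E ▸ hper)
        (hcover _ (E \ G) hd1 fun x hx hxM => ⟨hx.1, fun h => hx.2 ?_⟩)
        (hcover _ (G \ E) hd2 fun x hx hxM => ⟨?_, hx.2⟩)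
      · exact (hPs x).2 ((hM _ hxM).1 h)
      · exact (hM _ hxM).2 ((hPs x).1 hx.1)
    · refine exists_bound_per_interval hHm hint hE.compl (hHc E ▸ hper)
        (by rwa [compl_compl])
        (hcover _ (G \ E) hd2 fun x hx hxM => ⟨?_, hx.1⟩)
        (hcover _ (E \ G) hd1 fun x hx hxM => ⟨not_not.1 hx.2, fun h => ?_⟩)
      · exact (hM _ hxM).2 (not_le.1 fun h => hx.2 ((hPs x).2 h))
      · exact absurd ((hM _ hxM).1 h) (not_lt.2 ((hPs x).1 hx.1))
  -- The length `m` is chosen so that the profile forces the perimeter of an interval above `B`.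
  set β := B.toReal with hβ
  have hβ0 : 0 ≤ β := ENNReal.toReal_nonneg
  set m : ℝ≥0 := Real.toNNReal ((C * (β + 1)) ^ k) with hm
  have hmpos : 0 < (C * (β + 1)) ^ k := by positivity
  have hm0 : 0 < m := Real.toNNReal_pos.2 hmpos
  have hmr : (m : ℝ) = (C * (β + 1)) ^ k := Real.coe_toNNReal _ hmpos.le
  have hprof := (hg m hm0).trans (profile_le_per hN (hK.aemeasurable hN)
    (fun t ht => hK.volume_superlevel_ne_top ht)
    (E := {x : EuclideanSpace ℝ (Fin 1) | 0 ≤ x 0 ∧ x 0 < (m : ℝ)})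
    (measurableSet_Ico_one 0 m) (by rw [volume_Ico_one, sub_zero, ENNReal.ofReal_coe_nnreal]))
  rw [← hHper, hmr, ← Real.rpow_mul (by positivity), mul_one_div_cancel (by linarith),
    Real.rpow_one, mul_div_cancel_left₀ _ hC.ne'] at hprof
  have hBm := hBper m
  rw [hmr] at hBm
  have := hprof.trans hBm
  rw [← ENNReal.ofReal_toReal hB, ENNReal.ofReal_le_ofReal_iff ENNReal.toReal_nonneg] at this
  linarith

/-- The isoperimetric inequality with the power lower bound of the profile, for arbitrary
measurable sets. -/
theorem min_volume_rpow_le (hN : N ≠ 0) {K : EuclideanSpace ℝ (Fin N) → ℝ≥0}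
    (hK : IsKernel K) {μ r : ℝ} (hμ : 0 < μ) (hr : 0 < r)
    (hK0 : ∀ x ∈ Metric.ball (0 : EuclideanSpace ℝ (Fin N)) r, μ ≤ (K x : ℝ))
    {k C : ℝ} (hk : 1 ≤ k) (hC : 0 < C)
    (hg : ∀ m : ℝ≥0, 0 < m → ENNReal.ofReal ((m : ℝ) ^ (1 / k) / C) ≤ profile K m)
    {E : Set (EuclideanSpace ℝ (Fin N))} (hE : MeasurableSet E) :
    min (volume E) (volume Eᶜ) ^ (1 / k) ≤
      ENNReal.ofReal C * per (fun x => (K x : ℝ≥0∞)) E := by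
  have hk0 : 0 < 1 / k := by positivity
  have hfin : ∀ {F : Set (EuclideanSpace ℝ (Fin N))}, MeasurableSet F → volume F ≠ ⊤ →
      volume F ^ (1 / k) ≤ ENNReal.ofReal C * per (fun x => (K x : ℝ≥0∞)) F := by
    intro F hF hFf
    lift volume F to ℝ≥0 using hFf with m hm
    rcases eq_or_ne m 0 with rfl | hm0
    · rw [ENNReal.coe_zero, ENNReal.zero_rpow_of_pos hk0]
      exact zero_le
    · have h := (hg m (pos_iff_ne_zero.2 hm0)).trans (profile_le_per hN (hK.aemeasurable hN)
        (fun t ht => hK.volume_superlevel_ne_top ht) hF hm.symm)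
      refine le_trans ?_ (mul_le_mul_right h (ENNReal.ofReal C))
      rw [← ENNReal.ofReal_mul hC.le, mul_div_cancel₀ _ hC.ne', ← ENNReal.ofReal_coe_nnreal,
        ENNReal.ofReal_rpow_of_nonneg (NNReal.coe_nonneg _) hk0.le]
  obtain ⟨H, hHm, hHK, hHper, hHc⟩ := hK.exists_measurable hN
  by_cases h1 : volume E = ⊤
  · by_cases h2 : volume Eᶜ = ⊤
    · rw [per_eq_top hN hK hμ hr hK0 hk hC hg hE h1 h2, ENNReal.mul_top (by simpa using hC)]
      exact le_top
    · calc _ ≤ volume Eᶜ ^ (1 / k) := by gcongr; exact min_le_right _ _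
        _ ≤ _ := by
          refine (hfin hE.compl h2).trans (le_of_eq ?_)
          rw [← hHper, hHc, hHper]
  · calc _ ≤ volume E ^ (1 / k) := by gcongr; exact min_le_left _ _
      _ ≤ _ := hfin hE h1

/-! ### Minkowski's integral inequality -/

section Minkowski

variable {α β : Type*} [MeasurableSpace α] [MeasurableSpace β] {μ : Measure α} {ν : Measure β}
  [SFinite ν]

/-- Minkowski's integral inequality for a function `g` of finite `L^p` norm below the integral:
pair `g` with its dual power `g ^ (p - 1)` and apply Hölder's inequality in `x` for each `t`. -/
theorem lintegral_rpow_le_of_le_lintegral [SFinite μ] {h : β → α → ℝ≥0∞}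
    (hh : Measurable (Function.uncurry h)) {p : ℝ} (hp : 1 ≤ p) {g : α → ℝ≥0∞} (hg : Measurable g)
    (hgh : ∀ x, g x ≤ ∫⁻ t, h t x ∂ν) (hfin : ∫⁻ x, g x ^ p ∂μ ≠ ⊤) :
    ∫⁻ x, g x ^ p ∂μ ≤ (∫⁻ t, (∫⁻ x, h t x ^ p ∂μ) ^ (1 / p) ∂ν) ^ p := by
  have hswap : Measurable (Function.uncurry fun x t => h t x) := hh.comp measurable_swap
  have hp0 : 0 < p := by linarith
  rcases eq_or_lt_of_le hp with rfl | hp1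
  · simp only [ENNReal.rpow_one, div_one]
    rw [lintegral_lintegral_swap hh.aemeasurable]
    exact lintegral_mono hgh
  have hpq := Real.HolderConjugate.conjExponent hp1
  set q := p.conjExponent
  set G := ∫⁻ x, g x ^ p ∂μ with hG
  set R := ∫⁻ t, (∫⁻ x, h t x ^ p ∂μ) ^ (1 / p) ∂ν with hR
  have hht : ∀ t, Measurable (h t) := fun t => hh.of_uncurry_left
  have h1 : G ≤ R * G ^ (1 / q) := by
    calc G = ∫⁻ x, g x * g x ^ (p - 1) ∂μ := by
          refine lintegral_congr fun x => ?_
          conv_rhs => rw [← ENNReal.rpow_one (g x), ← ENNReal.rpow_mul,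
            ← ENNReal.rpow_add_of_nonneg _ _ zero_le_one (by linarith)]
          congr 1; ring
      _ ≤ ∫⁻ x, (∫⁻ t, h t x ∂ν) * g x ^ (p - 1) ∂μ := by
          refine lintegral_mono fun x => ?_
          gcongr
          exact hgh x
      _ = ∫⁻ x, ∫⁻ t, h t x * g x ^ (p - 1) ∂ν ∂μ := by
          refine lintegral_congr fun x => ?_
          rw [lintegral_mul_const _ hswap.of_uncurry_left]
      _ = ∫⁻ t, ∫⁻ x, h t x * g x ^ (p - 1) ∂μ ∂ν :=
          lintegral_lintegral_swap (hswap.mul ((hg.pow_const _).comp measurable_fst)).aemeasurable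
      _ ≤ ∫⁻ t, (∫⁻ x, h t x ^ p ∂μ) ^ (1 / p) * G ^ (1 / q) ∂ν := by
          refine lintegral_mono fun t => ?_
          refine (ENNReal.lintegral_mul_le_Lp_mul_Lq μ hpq (hht t).aemeasurable
            (hg.pow_const (p - 1)).aemeasurable).trans (le_of_eq ?_)
          simp only [← ENNReal.rpow_mul, hpq.sub_one_mul_conj]
          rfl
      _ = R * G ^ (1 / q) :=
          lintegral_mul_const _ (((hh.pow_const p).lintegral_prod_right').pow_const _)
  rcases eq_or_ne G 0 with hG0 | hG0
  · rw [hG0]; exact zero_le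
  have hq0 : 0 ≤ 1 / q := one_div_nonneg.2 hpq.symm.nonneg
  have h2 : G = G ^ (1 / p) * G ^ (1 / q) := by
    rw [← ENNReal.rpow_add_of_nonneg _ _ (by positivity) hq0, one_div, one_div,
      hpq.inv_add_inv_eq_one, ENNReal.rpow_one]
  have h3 : G ^ (1 / p) ≤ R := by
    rw [h2] at h1
    nth_rewrite 2 [← h2] at h1
    refine (ENNReal.mul_le_mul_iff_left ?_ (ENNReal.rpow_ne_top_of_nonneg hq0 hfin)).1 h1
    exact (ENNReal.rpow_pos (pos_iff_ne_zero.2 hG0) hfin).ne'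
  calc G = (G ^ (1 / p)) ^ p := by
        rw [← ENNReal.rpow_mul, one_div_mul_cancel hp0.ne', ENNReal.rpow_one]
    _ ≤ _ := by gcongr

/-- **Minkowski's integral inequality**. -/
theorem lintegral_rpow_lintegral_le [SigmaFinite μ] {h : β → α → ℝ≥0∞}
    (hh : Measurable (Function.uncurry h)) {p : ℝ} (hp : 1 ≤ p) :
    (∫⁻ x, (∫⁻ t, h t x ∂ν) ^ p ∂μ) ^ (1 / p) ≤ ∫⁻ t, (∫⁻ x, h t x ^ p ∂μ) ^ (1 / p) ∂ν := by
  have hp0 : 0 < p := by linarith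
  set R := ∫⁻ t, (∫⁻ x, h t x ^ p ∂μ) ^ (1 / p) ∂ν
  set f : α → ℝ≥0∞ := fun x => ∫⁻ t, h t x ∂ν with hf
  have hfm : Measurable f := hh.lintegral_prod_left'
  set g : ℕ → α → ℝ≥0∞ := fun n => (spanningSets μ n).indicator fun x => min (f x) n with hg
  have hgm : ∀ n, Measurable (g n) := fun n =>
    (hfm.min measurable_const).indicator (measurableSet_spanningSets μ n)
  have hgf : ∀ n x, g n x ≤ f x := fun n x =>
    (Set.indicator_le_self' (fun _ _ => zero_le) x).trans (min_le_left _ _)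
  have hgmono : ∀ x, Monotone fun n => g n x := by
    intro x n m hnm
    simp only [hg]
    by_cases hx : x ∈ spanningSets μ n
    · rw [Set.indicator_of_mem hx, Set.indicator_of_mem (monotone_spanningSets μ hnm hx)]
      exact min_le_min le_rfl (by exact_mod_cast hnm)
    · rw [Set.indicator_of_notMem hx]
      exact zero_le
  have hgfin : ∀ n, ∫⁻ x, g n x ^ p ∂μ ≠ ⊤ := by
    intro n
    have : ∀ x, g n x ^ p ≤ (spanningSets μ n).indicator (fun _ => (n : ℝ≥0∞) ^ p) x := by
      intro x
      simp only [hg]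
      by_cases hx : x ∈ spanningSets μ n
      · rw [Set.indicator_of_mem hx, Set.indicator_of_mem hx]
        gcongr
        exact min_le_right _ _
      · rw [Set.indicator_of_notMem hx, Set.indicator_of_notMem hx, ENNReal.zero_rpow_of_pos hp0]
    refine ne_top_of_le_ne_top ?_ (lintegral_mono this)
    rw [lintegral_indicator (measurableSet_spanningSets μ n), setLIntegral_const]
    exact ENNReal.mul_ne_top (ENNReal.rpow_ne_top_of_nonneg hp0.le (ENNReal.natCast_ne_top n))
      (measure_spanningSets_lt_top μ n).ne
  have htend : Filter.Tendsto (fun n => ∫⁻ x, g n x ^ p ∂μ) Filter.atTop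
      (nhds (∫⁻ x, f x ^ p ∂μ)) := by
    refine lintegral_tendsto_of_tendsto_of_monotone (fun n => ((hgm n).pow_const p).aemeasurable)
      (Filter.Eventually.of_forall fun x n m hnm => by
        have := hgmono x hnm
        simp only at this ⊢
        gcongr) (Filter.Eventually.of_forall fun x => ?_)
    refine (ENNReal.continuous_rpow_const.tendsto (f x)).comp ?_
    have h1 : Filter.Tendsto (fun n : ℕ => min (f x) (n : ℝ≥0∞)) Filter.atTop (nhds (f x)) := by
      simpa using (tendsto_const_nhds (x := f x)).min ENNReal.tendsto_nat_nhds_top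
    refine h1.congr' ?_
    filter_upwards [Filter.eventually_ge_atTop (spanningSetsIndex μ x)] with n hn
    simp only [hg]
    rw [Set.indicator_of_mem (monotone_spanningSets μ hn (mem_spanningSetsIndex μ x))]
  have hle : ∫⁻ x, f x ^ p ∂μ ≤ R ^ p := le_of_tendsto' htend fun n =>
    lintegral_rpow_le_of_le_lintegral hh hp (hgm n) (hgf n) (hgfin n)
  calc (∫⁻ x, f x ^ p ∂μ) ^ (1 / p) ≤ (R ^ p) ^ (1 / p) := by gcongr
    _ = R := by rw [← ENNReal.rpow_mul, mul_one_div_cancel hp0.ne', ENNReal.rpow_one]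

end Minkowski

/-! ### The coarea formula -/

theorem volume_Ico_add_volume_Ico (a b : ℝ) :
    volume (Set.Ico a b) + volume (Set.Ico b a) = ‖b - a‖ₑ := by
  rw [Real.volume_Ico, Real.volume_Ico, ← neg_sub b a, ofReal_add_ofReal_neg, ← Real.norm_eq_abs,
    ofReal_norm]

theorem lintegral_lintegral_mul_eq_lintegral_per {H : EuclideanSpace ℝ (Fin N) → ℝ≥0∞}
    (hH : Measurable H) {u : EuclideanSpace ℝ (Fin N) → ℝ} (hu : Measurable u) :
    ∫⁻ x, ∫⁻ y, ‖u x - u y‖ₑ * H (x - y) =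
      ∫⁻ t : ℝ, (per H {x | t < u x} + per H {x | t < u x}ᶜ) := by
  set S : Set ((EuclideanSpace ℝ (Fin N) × ℝ) × EuclideanSpace ℝ (Fin N)) :=
    {q | q.1.2 < u q.1.1 ∧ u q.2 ≤ q.1.2} with hSdef
  set S' : Set ((EuclideanSpace ℝ (Fin N) × ℝ) × EuclideanSpace ℝ (Fin N)) :=
    {q | q.1.2 < u q.2 ∧ u q.1.1 ≤ q.1.2} with hSdef'
  have m1 : Measurable fun q : (EuclideanSpace ℝ (Fin N) × ℝ) × EuclideanSpace ℝ (Fin N) =>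
      q.1.2 := by fun_prop
  have m2 : Measurable fun q : (EuclideanSpace ℝ (Fin N) × ℝ) × EuclideanSpace ℝ (Fin N) =>
      u q.1.1 := by fun_prop
  have m3 : Measurable fun q : (EuclideanSpace ℝ (Fin N) × ℝ) × EuclideanSpace ℝ (Fin N) =>
      u q.2 := by fun_prop
  have hS : MeasurableSet S := (measurableSet_lt m1 m2).inter (measurableSet_le m3 m1)
  have hS' : MeasurableSet S' := (measurableSet_lt m1 m3).inter (measurableSet_le m2 m1)
  set F : (EuclideanSpace ℝ (Fin N) × ℝ) × EuclideanSpace ℝ (Fin N) → ℝ≥0∞ := fun q =>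
    S.indicator (fun q => H (q.1.1 - q.2)) q + S'.indicator (fun q => H (q.1.1 - q.2)) q with hF
  have hm1 : Measurable (S.indicator fun q => H (q.1.1 - q.2)) :=
    (hH.comp (by fun_prop)).indicator hS
  have hm2 : Measurable (S'.indicator fun q => H (q.1.1 - q.2)) :=
    (hH.comp (by fun_prop)).indicator hS'
  have hFm : Measurable F := hm1.add hm2
  have hlayer : ∀ x y, ‖u x - u y‖ₑ * H (x - y) = ∫⁻ t : ℝ, F ((x, t), y) := by
    intro x y
    have e : ∀ t : ℝ, F ((x, t), y) = (Set.Ico (u y) (u x)).indicator (fun _ => H (x - y)) t +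
        (Set.Ico (u x) (u y)).indicator (fun _ => H (x - y)) t := by
      intro t
      simp only [hF, Set.indicator, hSdef, hSdef', Set.mem_Ico]
      congr 1 <;> refine if_congr and_comm rfl rfl
    simp only [e]
    rw [lintegral_add_left (measurable_const.indicator measurableSet_Ico),
      lintegral_indicator measurableSet_Ico, lintegral_indicator measurableSet_Ico,
      setLIntegral_const, setLIntegral_const, ← mul_add, volume_Ico_add_volume_Ico, mul_comm]
  have hinner : ∀ (E : Set (EuclideanSpace ℝ (Fin N))), MeasurableSet E → per H E =
      ∫⁻ x, ∫⁻ y, {q : EuclideanSpace ℝ (Fin N) × EuclideanSpace ℝ (Fin N) |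
        q.1 ∈ E ∧ q.2 ∉ E}.indicator (fun q => H (q.1 - q.2)) (x, y) := by
    intro E hE
    rw [per, ← lintegral_indicator hE]
    refine lintegral_congr fun x => ?_
    by_cases hx : x ∈ E
    · rw [Set.indicator_of_mem hx, ← lintegral_indicator hE.compl]
      refine lintegral_congr fun y => ?_
      by_cases hy : y ∈ E <;> simp [hx, hy]
    · rw [Set.indicator_of_notMem hx]
      simp [Set.indicator, hx]
  calc ∫⁻ x, ∫⁻ y, ‖u x - u y‖ₑ * H (x - y)
      = ∫⁻ x, ∫⁻ t : ℝ, ∫⁻ y, F ((x, t), y) := by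
        refine lintegral_congr fun x => ?_
        simp only [hlayer]
        refine lintegral_lintegral_swap (hFm.comp ?_).aemeasurable
        exact (by fun_prop : Measurable fun p : EuclideanSpace ℝ (Fin N) × ℝ => ((x, p.2), p.1))
    _ = ∫⁻ t : ℝ, ∫⁻ x, ∫⁻ y, F ((x, t), y) :=
        lintegral_lintegral_swap hFm.lintegral_prod_right'.aemeasurable
    _ = _ := by
        refine lintegral_congr fun t => ?_
        have hE : MeasurableSet {x | t < u x} := measurableSet_lt measurable_const hu
        have hmap : Measurable fun p : EuclideanSpace ℝ (Fin N) × EuclideanSpace ℝ (Fin N) =>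
          ((p.1, t), p.2) := by fun_prop
        rw [hinner _ hE, hinner _ hE.compl]
        have e1 : ∀ x, ∫⁻ y, F ((x, t), y) =
            (∫⁻ y, S.indicator (fun q => H (q.1.1 - q.2)) ((x, t), y)) +
            ∫⁻ y, S'.indicator (fun q => H (q.1.1 - q.2)) ((x, t), y) := fun x =>
          lintegral_add_left (hm1.comp (by fun_prop : Measurable fun y => ((x, t), y))) _
        simp only [e1]
        have hm3 : Measurable fun x =>
            ∫⁻ y, S.indicator (fun q => H (q.1.1 - q.2)) ((x, t), y) :=
          (hm1.comp hmap).lintegral_prod_right'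
        rw [lintegral_add_left hm3]
        congr 1 <;> refine lintegral_congr fun x => lintegral_congr fun y => ?_
        · simp [Set.indicator, hSdef]
        · simp [Set.indicator, hSdef', and_comm]

/-- A measurable representative of a kernel computes the energy of measurable functions through
the perimeters of their superlevel sets. -/
theorem energy_eq_lintegral_per {K : EuclideanSpace ℝ (Fin N) → ℝ≥0}
    {H : EuclideanSpace ℝ (Fin N) → ℝ≥0∞} (hH : Measurable H)
    (hHK : H =ᵐ[volume] fun x => (K x : ℝ≥0∞)) (hHc : ∀ E, per H Eᶜ = per H E)
    {u : EuclideanSpace ℝ (Fin N) → ℝ} (hu : Measurable u) :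
    energy K u = ∫⁻ t : ℝ, per H {x | t < u x} := by
  have h1 : ∫⁻ x, ∫⁻ y, ‖u x - u y‖ₑ * (K (x - y) : ℝ≥0∞) =
      ∫⁻ x, ∫⁻ y, ‖u x - u y‖ₑ * H (x - y) := by
    refine lintegral_congr fun x => lintegral_congr_ae ?_
    filter_upwards [(Measure.measurePreserving_sub_left volume x).quasiMeasurePreserving.ae hHK]
      with y hy
    rw [hy]
  rw [energy, h1, lintegral_lintegral_mul_eq_lintegral_per hH hu]
  simp only [hHc, ← two_mul]
  rw [lintegral_const_mul' _ _ (by simp), ← mul_assoc, ENNReal.inv_mul_cancel (by simp) (by simp),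
    one_mul]

theorem energy_congr {K : EuclideanSpace ℝ (Fin N) → ℝ≥0}
    {u v : EuclideanSpace ℝ (Fin N) → ℝ} (h : u =ᵐ[volume] v) : energy K u = energy K v := by
  rw [energy, energy]
  congr 1
  refine lintegral_congr_ae ?_
  filter_upwards [h] with x hx
  refine lintegral_congr_ae ?_
  filter_upwards [h] with y hy
  rw [hx, hy]

/-! ### The infimal level -/

theorem levelInf_congr {u v : EuclideanSpace ℝ (Fin N) → ℝ} (h : u =ᵐ[volume] v) :
    levelInf u = levelInf v := by
  have : ∀ s : ℝ, volume {x | s < u x} = volume {x | s < v x} := by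
    intro s
    refine measure_congr ?_
    filter_upwards [h] with x hx
    change (s < u x) = (s < v x)
    rw [hx]
  simp only [levelInf, this]

theorem levelInf_eq_coe {u : EuclideanSpace ℝ (Fin N) → ℝ} {a : ℝ}
    (h : IsGLB {s : ℝ | volume {x | s < u x} < ⊤} a)
    (hne : {s : ℝ | volume {x | s < u x} < ⊤}.Nonempty) : levelInf u = a := by
  refine IsGLB.sInf_eq ⟨?_, ?_⟩
  · rintro _ ⟨s, hs, rfl⟩
    exact EReal.coe_le_coe_iff.2 (h.1 hs)
  · intro c hc
    induction c using EReal.rec with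
    | bot => exact bot_le
    | coe r =>
      exact EReal.coe_le_coe_iff.2 (h.2 fun s hs => EReal.coe_le_coe_iff.1 (hc ⟨s, hs, rfl⟩))
    | top =>
      obtain ⟨s, hs⟩ := hne
      exact absurd (hc ⟨s, hs, rfl⟩) (not_le.2 (EReal.coe_lt_top s))

theorem volume_univ_eq_top (hN : N ≠ 0) :
    volume (Set.univ : Set (EuclideanSpace ℝ (Fin N))) = ⊤ := by
  have : Nonempty (Fin N) := ⟨⟨0, Nat.pos_of_ne_zero hN⟩⟩
  exact measure_univ_of_isAddLeftInvariant _

theorem levelInf_eq_zero_of_integrable (hN : N ≠ 0) {u : EuclideanSpace ℝ (Fin N) → ℝ}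
    (hu : Integrable u) : levelInf u = 0 := by
  have hpos : ∀ s : ℝ, 0 < s → s ∈ {s : ℝ | volume {x | s < u x} < ⊤} := fun s hs =>
    hu.measure_gt_lt_top hs
  refine levelInf_eq_coe (a := 0) ⟨fun s hs => ?_, fun c hc => ?_⟩ ⟨1, hpos 1 one_pos⟩
  · by_contra! hlt
    refine absurd (volume_univ_eq_top hN) (ne_of_lt ?_)
    calc volume Set.univ ≤ volume ({x | s < u x} ∪ {x | u x ≤ s}) :=
          measure_mono fun x _ => lt_or_ge s (u x)
      _ ≤ _ := measure_union_le _ _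
      _ < ⊤ := ENNReal.add_lt_top.2 ⟨hs, hu.measure_le_lt_top hlt⟩
  · exact le_of_forall_gt_imp_ge_of_dense fun s hs => hc (hpos s hs)

/-! ### The Sobolev-type inequality -/

variable {u : EuclideanSpace ℝ (Fin N) → ℝ}

theorem exists_volume_superlevel_ne_top (hN : N ≠ 0) {k : ℝ} (hk : 0 < k)
    (hφ : ∫⁻ t : ℝ, min (volume {x | t < u x}) (volume {x | t < u x}ᶜ) ^ (1 / k) ≠ ⊤) :
    ∃ s, volume {x | s < u x} ≠ ⊤ := by
  by_contra! hall
  have hun : (⋃ n : ℕ, {x | (n : ℝ) < u x}ᶜ) = Set.univ := by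
    refine Set.eq_univ_of_forall fun x => ?_
    obtain ⟨n, hn⟩ := exists_nat_ge (u x)
    exact Set.mem_iUnion.2 ⟨n, not_lt.2 hn⟩
  obtain ⟨n, hn⟩ : ∃ n : ℕ, volume {x | (n : ℝ) < u x}ᶜ ≠ 0 := by
    by_contra! h0
    have := measure_iUnion_null (μ := volume) h0
    rw [hun, volume_univ_eq_top hN] at this
    exact ENNReal.top_ne_zero this
  refine hφ (top_le_iff.1 ?_)
  calc (⊤ : ℝ≥0∞) = ∫⁻ _ in Set.Ioi (n : ℝ), volume {x | (n : ℝ) < u x}ᶜ ^ (1 / k) := by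
        rw [setLIntegral_const, Real.volume_Ioi, ENNReal.mul_top]
        exact fun h => hn ((ENNReal.rpow_eq_zero_iff_of_pos (by positivity)).1 h)
    _ ≤ ∫⁻ t in Set.Ioi (n : ℝ), min (volume {x | t < u x}) (volume {x | t < u x}ᶜ) ^ (1 / k) := by
        refine setLIntegral_mono' measurableSet_Ioi fun t ht => ?_
        rw [hall t, min_eq_right le_top]
        gcongr
        exact (Set.mem_Ioi.1 ht).le
    _ ≤ _ := setLIntegral_le_lintegral _ _

theorem exists_volume_superlevel_eq_top (hN : N ≠ 0) {k : ℝ} (hk : 0 < k) (hu : Measurable u)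
    (hφ : ∫⁻ t : ℝ, min (volume {x | t < u x}) (volume {x | t < u x}ᶜ) ^ (1 / k) ≠ ⊤) :
    ∃ s, volume {x | s < u x} = ⊤ := by
  by_contra! hall
  have hun : (⋃ n : ℕ, {x | -(n : ℝ) < u x}) = Set.univ := by
    refine Set.eq_univ_of_forall fun x => ?_
    obtain ⟨n, hn⟩ := exists_nat_gt (-u x)
    exact Set.mem_iUnion.2 ⟨n, by change -(n : ℝ) < u x; linarith⟩
  obtain ⟨n, hn⟩ : ∃ n : ℕ, volume {x | -(n : ℝ) < u x} ≠ 0 := by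
    by_contra! h0
    have := measure_iUnion_null (μ := volume) h0
    rw [hun, volume_univ_eq_top hN] at this
    exact ENNReal.top_ne_zero this
  refine hφ (top_le_iff.1 ?_)
  calc (⊤ : ℝ≥0∞) = ∫⁻ _ in Set.Iio (-(n : ℝ)), volume {x | -(n : ℝ) < u x} ^ (1 / k) := by
        rw [setLIntegral_const, Real.volume_Iio, ENNReal.mul_top]
        exact fun h => hn ((ENNReal.rpow_eq_zero_iff_of_pos (by positivity)).1 h)
    _ ≤ ∫⁻ t in Set.Iio (-(n : ℝ)),
          min (volume {x | t < u x}) (volume {x | t < u x}ᶜ) ^ (1 / k) := by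
        refine setLIntegral_mono' measurableSet_Iio fun t ht => ?_
        have hc : volume {x | t < u x}ᶜ = ⊤ := by
          have h := measure_add_measure_compl (μ := volume)
            (show MeasurableSet {x | t < u x} from measurableSet_lt measurable_const hu)
          rw [volume_univ_eq_top hN] at h
          exact (ENNReal.add_eq_top.1 h).resolve_left (hall t)
        rw [hc, min_eq_left le_top]
        gcongr
        exact (Set.mem_Iio.1 ht).le
    _ ≤ _ := setLIntegral_le_lintegral _ _

/-- If the smaller of the measures of the superlevel sets and of their complements has an
integrable power, then the function has a finite infimal level `a`, and the distance from `a` is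
controlled by applying Minkowski's inequality to the layer cake decomposition of `|u - a|`. -/
theorem exists_levelInf_eq_and_eLpNorm_le (hN : N ≠ 0) {k : ℝ} (hk : 1 ≤ k) (hu : Measurable u)
    (hφ : ∫⁻ t : ℝ, min (volume {x | t < u x}) (volume {x | t < u x}ᶜ) ^ (1 / k) ≠ ⊤) :
    ∃ a : ℝ, levelInf u = a ∧ eLpNorm (fun x => u x - a) (ENNReal.ofReal k) volume ≤
      ∫⁻ t : ℝ, min (volume {x | t < u x}) (volume {x | t < u x}ᶜ) ^ (1 / k) := by
  have hk0 : 0 < k := by linarith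
  set S : Set ℝ := {s : ℝ | volume {x | s < u x} < ⊤} with hS
  have hup : ∀ {s t}, s ∈ S → s ≤ t → t ∈ S := fun {s t} hs hst =>
    lt_of_le_of_lt (measure_mono fun x (hx : t < u x) => lt_of_le_of_lt hst hx) hs
  obtain ⟨s₁, hs₁⟩ := exists_volume_superlevel_ne_top hN hk0 hφ
  obtain ⟨s₀, hs₀⟩ := exists_volume_superlevel_eq_top hN hk0 hu hφ
  have hne : S.Nonempty := ⟨s₁, lt_top_iff_ne_top.2 hs₁⟩
  have hbdd : BddBelow S := ⟨s₀, fun s hs => by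
    by_contra! h
    exact (hup hs h.le).ne hs₀⟩
  set a := sInf S with ha
  refine ⟨a, levelInf_eq_coe (isGLB_csInf hne hbdd) hne, ?_⟩
  set A : ℝ → Set (EuclideanSpace ℝ (Fin N)) := fun t =>
    {x | (a ≤ t ∧ t < u x) ∨ (t < a ∧ u x ≤ t)} with hA
  have m2 : Measurable fun p : ℝ × EuclideanSpace ℝ (Fin N) => u p.2 := by fun_prop
  have hAmeas : MeasurableSet {p : ℝ × EuclideanSpace ℝ (Fin N) | p.2 ∈ A p.1} :=
    ((measurableSet_le measurable_const measurable_fst).inter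
      (measurableSet_lt measurable_fst m2)).union
    ((measurableSet_lt measurable_fst measurable_const).inter (measurableSet_le m2 measurable_fst))
  have hAt : ∀ t, MeasurableSet (A t) := fun t => measurable_prodMk_left hAmeas
  set h : ℝ → EuclideanSpace ℝ (Fin N) → ℝ≥0∞ := fun t => (A t).indicator fun _ => 1 with hh
  have hhm : Measurable (Function.uncurry h) := measurable_const.indicator hAmeas
  have hlayer : ∀ x, ‖u x - a‖ₑ = ∫⁻ t, h t x := by
    intro x
    have e : ∀ t, h t x = (Set.Ico a (u x)).indicator (fun _ => 1) t +
        (Set.Ico (u x) a).indicator (fun _ => 1) t := by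
      intro t
      simp only [hh, hA, Set.indicator, Set.mem_Ico]
      by_cases h1 : a ≤ t
      · simp [h1, not_lt.2 h1]
      · simp [h1, not_le.1 h1]
    simp only [e]
    rw [lintegral_add_left (measurable_const.indicator measurableSet_Ico),
      lintegral_indicator_const measurableSet_Ico, lintegral_indicator_const measurableSet_Ico,
      one_mul, one_mul, volume_Ico_add_volume_Ico]
  have hvol : ∀ t, t ≠ a → volume (A t) = min (volume {x | t < u x}) (volume {x | t < u x}ᶜ) := by
    intro t hta
    have hsum := measure_add_measure_compl (μ := volume)
      (show MeasurableSet {x | t < u x} from measurableSet_lt measurable_const hu)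
    rw [volume_univ_eq_top hN] at hsum
    rcases lt_or_gt_of_ne hta with hlt | hgt
    · have h1 : volume {x | t < u x} = ⊤ := by
        by_contra hcon
        exact absurd (csInf_le hbdd (show t ∈ S from lt_top_iff_ne_top.2 hcon)) (not_le.2 hlt)
      rw [h1, min_eq_right le_top]
      congr 1
      ext x
      simp [hA, hlt, not_le.2 hlt]
    · obtain ⟨s, hs, hst⟩ := exists_lt_of_csInf_lt hne hgt
      have h1 : volume {x | t < u x} ≠ ⊤ := (hup hs hst.le).ne
      have h2 : volume {x | t < u x}ᶜ = ⊤ := (ENNReal.add_eq_top.1 hsum).resolve_left h1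
      rw [h2, min_eq_left le_top]
      congr 1
      ext x
      simp [hA, hgt.le, not_lt.2 hgt.le]
  have hkt : (ENNReal.ofReal k).toReal = k := ENNReal.toReal_ofReal hk0.le
  rw [eLpNorm_eq_lintegral_rpow_enorm_toReal (by simpa using hk0) ENNReal.ofReal_ne_top, hkt]
  simp only [hlayer]
  refine (lintegral_rpow_lintegral_le hhm hk).trans (le_of_eq (lintegral_congr_ae ?_))
  filter_upwards [Measure.ae_ne volume a] with t hta
  rw [← hvol t hta]
  congr 1
  have e : ∀ x, h t x ^ k = (A t).indicator (fun _ => 1) x := by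
    intro x
    by_cases hx : x ∈ A t
    · simp [hh, hx]
    · simp [hh, hx, hk0]
  simp only [e]
  rw [lintegral_indicator_const (hAt t), one_mul]

end NonlocalPerimeter

theorem proposition4p1 (N : ℕ) (hN : 1 ≤ N)
    (K : EuclideanSpace ℝ (Fin N) → ℝ≥0)
    (hK : NonlocalPerimeter.IsKernel K)
    (hK0 : ∃ μ r : ℝ, 0 < μ ∧ 0 < r ∧
      ∀ x ∈ Metric.ball (0 : EuclideanSpace ℝ (Fin N)) r, μ ≤ (K x : ℝ))
    (k C : ℝ) (hk : 1 ≤ k) (hC : 0 < C)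
    (hg : ∀ m : ℝ≥0, 0 < m →
      ENNReal.ofReal ((m : ℝ) ^ (1 / k) / C) ≤ NonlocalPerimeter.profile K m) :
    (∀ u : EuclideanSpace ℝ (Fin N) → ℝ, LocallyIntegrable u volume →
      NonlocalPerimeter.energy K u < ⊤ →
      ∃ a : ℝ, NonlocalPerimeter.levelInf u = (a : EReal) ∧
        eLpNorm (fun x => u x - a) (ENNReal.ofReal k) volume
          ≤ ENNReal.ofReal C * NonlocalPerimeter.energy K u) ∧
    (∀ u : EuclideanSpace ℝ (Fin N) → ℝ, Integrable u volume →
      NonlocalPerimeter.levelInf u = 0) := by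
  open NonlocalPerimeter in
  have hN0 : N ≠ 0 := Nat.one_le_iff_ne_zero.1 hN
  refine ⟨fun u hu hJ => ?_, fun u hu => levelInf_eq_zero_of_integrable hN0 hu⟩
  obtain ⟨μ, r, hμ, hr, hK0⟩ := hK0
  obtain ⟨H, hHm, hHK, hHper, hHc⟩ := hK.exists_measurable hN0
  have hus := hu.aestronglyMeasurable
  set v := hus.mk u with hv
  have hvm : Measurable v := hus.stronglyMeasurable_mk.measurable
  have huv : u =ᵐ[volume] v := hus.ae_eq_mk
  have hbound : ∫⁻ t : ℝ, min (volume {x | t < v x}) (volume {x | t < v x}ᶜ) ^ (1 / k) ≤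
      ENNReal.ofReal C * energy K u := by
    rw [energy_congr huv, energy_eq_lintegral_per hHm hHK hHc hvm,
      ← lintegral_const_mul' _ _ ENNReal.ofReal_ne_top]
    refine lintegral_mono fun t => ?_
    have := min_volume_rpow_le hN0 hK hμ hr hK0 hk hC hg
      (show MeasurableSet {x | t < v x} from measurableSet_lt measurable_const hvm)
    rwa [← hHper] at this
  obtain ⟨a, ha, hle⟩ := exists_levelInf_eq_and_eLpNorm_le hN0 hk hvm
    (ne_top_of_le_ne_top (ENNReal.mul_ne_top ENNReal.ofReal_ne_top hJ.ne) hbound)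
  refine ⟨a, (levelInf_congr huv).trans ha, ?_⟩
  rw [eLpNorm_congr_ae (huv.mono fun x hx => show u x - a = v x - a by rw [hx])]
  exact hle.trans hbound
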